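/- Let $I=\{0,1\}$, let $\mathbb S$ be the left shift on $I^{\mathbb Z}$, let $\mathbb O$ be the odometer on $I^{\mathbb N}$ (addition of $1$ with carry to the right: $(1,\dots,1,0,*)\mapsto(0,\dots,0,1,*)$, and $(1,1,\dots)\mapsto(0,0,\dots)$), and let $m$ be the uniform product (Lebesgue) measure on $I^{\mathbb N}$. Let $\mathbb M$ be the set of $\mathbb S\times\mathbb O$-invariant Borel probability measures on $I^{\mathbb Z}\times I^{\mathbb N}$. For $k\ge 0$ let $\mathcal M_k$ be the set of $\mathbb S^{2^k}$-invariant Borel probability measures on $I^{\mathbb Z}$, and let $\operatorname{Ex}$ denote the set of extreme points. For $0\le r<2^k$ put $A_{r,k}=\{\alpha\in I^{\mathbb N}:\sum_{i=1}^k\alpha_i2^{i-1}=r\}$, and for $\eta\in\mathcal M_k$ put $$D_k[\eta]=\sum_{i=0}^{2^k-1}\mathbb S^i\eta\times(\chi_{A_{i,k}}m).$$ A measure $\nu$ is of periodic type $k$ if $k$ is the least number such that $\nu=D_k[\eta]$ for some $\eta\in\mathcal M_k$; a measure in $\mathbb M$ that is of no periodic type is aperiodic. For $\nu\in\mathbb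 M$ let $\theta_n[\nu]$ be the normalized projection to $I^{\mathbb Z}$ of the restriction of $\nu$ to $I^{\mathbb Z}\times A_{0,n}$. Let $\eta$ be an $\mathbb S$-invariant ergodic Borel probability measure on $I^{\mathbb Z}$, let $\varrho_n=e^{2\pi i/2^n}$, and let $f=(f_n)_{n\ge0}$ be measurable functions with $f_0=1$, $f_n=f_{n+1}^2$ and $f_n\circ\mathbb S=\varrho_nf_n$ $\eta$-almost everywhere. For $\alpha\in I^{\mathbb N}$ let $\nu^{(\alpha)}[\eta]$ be the measure $\nu\in\mathbb M$ such that, for every $n\ge0$, $\theta_n[\nu]$ is the normalized restriction of $\eta$ to $\{f_n=\varrho_n^{r(n,\alpha)}\}$, where $r(n,\alpha)=\sum_{k=0}^{n-1}2^k\alpha_{k+1}$. Let $\mathrm{OP}$ be the graded graph of ordered pairs: $\mathrm{OP}_0=I$, $\mathrm{OP}_{n+1}=\mathrm{OP}_n\times\mathrm{OP}_n$, and an edge with index $0$ (respectively $1$) goes from $v_0$ (respectively $v_1$) to $(v_0,v_1)$. Let $\mathcal T(\mathrm{OP})$ be the space of its infinite paths from floor $0$. A Borel probability measure on it is central if, for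 every $n$, given the path from floor $n$ on, the $2^n$ possible beginnings are equiprobable; it is ergodic if every Borel set that is invariant under the tail equivalence has measure $0$ or $1$. Let $\mathcal A$ be the adic transformation: if the first edge with index $0$ of a path leads to floor $n+1$, the path is replaced by the path that coincides with it from floor $n+1$ on, enters that floor along the edge with index $1$, and whose previous edges have index $0$. For a path $x$ on which all powers $\mathcal A^k$, $k\in\mathbb Z$, are defined, let $C(x)\in I^{\mathbb Z}\times I^{\mathbb N}$ have as its first component the sequence of the initial vertices of $\mathcal A^kx$, $k\in\mathbb Z$, and as its second component the sequence of the indices of the edges of $x$. **Theorem.** The pushforward under $C$ is a bijection from the set of ergodic central measures on $\mathcal T(\mathrm{OP})$ onto the set of ergodic measures in $\mathbb M$. The ergodic measures in $\mathbb M$ are the disjoint union of the following two classes. 1) The measures $D_k[\eta]$ with $k\ge0$ and $\eta\in\mathcal M_k\cap\operatorname{Ex}(\mathcal M_{k+1})$. For $\eta\in\mathcal M_k$ the measure $D_k[\eta]$ is ergodic if and only if $\eta\in\operatorname{Ex}(\mathcal M_{k+1})$. The ergodic measures of periodic type $k$ are exactly the $D_k[\eta]$ with $\eta\in\mathcal M_k\cap\operatorname{Ex}(\mathcal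 M_{k+1})$ and $\eta\notin\mathcal M_j$ for all $j<k$. The projections to $I^{\mathbb Z}$ of the ergodic measures of periodic type $k$ are exactly the $\mathbb S$-invariant ergodic probability measures $\widetilde\eta$ such that the shift on $(I^{\mathbb Z},\widetilde\eta)$ has a quotient isomorphic to the cyclic rotation of $2^k$ points with the uniform measure, but none isomorphic to the rotation of $2^{k+1}$ points. 2) The measures $\nu^{(\alpha)}[\eta]$, where $\eta$ is $\mathbb S$-invariant and ergodic, the shift on $(I^{\mathbb Z},\eta)$ has a quotient isomorphic to the odometer $(I^{\mathbb N},m,\mathbb O)$, and $\alpha\in I^{\mathbb N}$. These are exactly the ergodic aperiodic measures. For each such $\eta$ a system $f$ as above exists; and, for every choice of $f$, the measure $\nu^{(\alpha)}[\eta]$ exists and is unique for every $\alpha\in I^{\mathbb N}$, and the measures $\nu^{(\alpha)}[\eta]$, $\alpha\in I^{\mathbb N}$, are exactly the ergodic aperiodic measures whose projection to $I^{\mathbb Z}$ is $\eta$. -/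

import Mathlib

open MeasureTheory Set

/-! ### Two-sided binary configurations, binary sequences, shift and odometer -/

/-- `I^ℤ` with `I = {0,1}` (`false = 0`, `true = 1`) and the product (Borel) σ-algebra. -/
abbrev Conf : Type := ℤ → Bool

/-- `I^ℕ`; the coordinate `α i` is the `(i+1)`-st digit of the sequence. -/
abbrev BSeq : Type := ℕ → Bool

/-- The left shift `𝕊` on `I^ℤ`. -/
def shift (w : Conf) : Conf := fun n => w (n + 1)

/-- The odometer `𝕆` on `I^ℕ`: it turns `1,…,1,0,*` into `0,…,0,1,*`. (The constant sequence `1`,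
on which the carry never stops, goes to the constant sequence `0`.) -/
def odometer (α : BSeq) : BSeq :=
  fun i => if ∀ j < i, α j = true then !(α i) else α i

/-- The inverse odometer: it turns `0,…,0,1,*` into `1,…,1,0,*`. -/
def odometerInv (α : BSeq) : BSeq :=
  fun i => if ∀ j < i, α j = false then !(α i) else α i

/-- The map `𝕊 × 𝕆` on `I^ℤ × I^ℕ`. -/
def shiftOdometer : Conf × BSeq → Conf × BSeq := Prod.map shift odometer

/-- The Lebesgue measure `m` on `I^ℕ`: the product of the uniform measures on `{0,1}`. -/
noncomputable def lebesgue : Measure BSeq :=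
  Measure.infinitePi fun _ : ℕ => (PMF.uniformOfFintype Bool).toMeasure

/-! ### Factors -/

/-- `(Y, ρ, R)` is a quotient (factor) of `(X, μ, T)`: there is a measure-preserving map `X → Y`
which intertwines `T` and `R` almost everywhere. -/
def HasFactor {X Y : Type} [MeasurableSpace X] [MeasurableSpace Y] (μ : Measure X) (T : X → X)
    (ρ : Measure Y) (R : Y → Y) : Prop :=
  ∃ p : X → Y, MeasurePreserving p μ ρ ∧ ∀ᵐ x ∂μ, p (T x) = R (p x)

/-- The shift on `(I^ℤ, η)` has a quotient isomorphic to the rotation of `2 ^ n` points with the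
uniform measure. -/
def HasRotationFactor (η : Measure Conf) (n : ℕ) : Prop :=
  HasFactor η shift (PMF.uniformOfFintype (ZMod (2 ^ n))).toMeasure (fun x => x + 1)

/-- The shift on `(I^ℤ, η)` has a quotient isomorphic to the odometer. -/
def HasOdometerFactor (η : Measure Conf) : Prop :=
  HasFactor η shift lebesgue odometer

/-! ### Invariant measures on `I^ℤ` and on `I^ℤ × I^ℕ` -/

/-- `𝓜_k`: the Borel probability measures on `I^ℤ` that are invariant under `𝕊^(2^k)`.
Its set of extreme points is `extremePoints ENNReal (shiftInv k)`. -/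
def shiftInv (k : ℕ) : Set (Measure Conf) :=
  {η | MeasurePreserving (shift^[2 ^ k]) η η ∧ IsProbabilityMeasure η}

/-- The Borel probability measures on `I^ℤ` that are invariant and ergodic for `𝕊`. -/
def shiftErg : Set (Measure Conf) :=
  {η | Ergodic shift η ∧ IsProbabilityMeasure η}

/-- `𝕄`: the `𝕊 × 𝕆`-invariant Borel probability measures on `I^ℤ × I^ℕ`. -/
def prodInv : Set (Measure (Conf × BSeq)) :=
  {ν | MeasurePreserving shiftOdometer ν ν ∧ IsProbabilityMeasure ν}

/-- The ergodic measures in `𝕄`. -/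
def prodErg : Set (Measure (Conf × BSeq)) :=
  {ν | Ergodic shiftOdometer ν ∧ IsProbabilityMeasure ν}

/-- The projection of `ν` to `I^ℤ`. -/
noncomputable def proj (ν : Measure (Conf × BSeq)) : Measure Conf := ν.map Prod.fst

/-- `∑_{i=1}^{k} α_i 2^{i-1}`, the number coded by the first `k` digits of `α`. -/
def digitSum (k : ℕ) (α : BSeq) : ℕ := ∑ i ∈ Finset.range k, (α i).toNat * 2 ^ i

/-- The cylinder `A_{r,k} ⊆ I^ℕ`. -/
def cyl (r k : ℕ) : Set BSeq := {α | digitSum k α = r}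

/-- `θ_k[ν]`: the normalized projection to `I^ℤ` of the restriction of `ν` to `I^ℤ × A_{0,k}`. -/
noncomputable def theta (k : ℕ) (ν : Measure (Conf × BSeq)) : Measure Conf :=
  proj (ProbabilityTheory.cond ν (univ ×ˢ cyl 0 k))

/-! ### Measures of periodic type and aperiodic measures -/

/-- `D_k[η] = ∑_{i < 2^k} 𝕊^i η × (χ_{A_{i,k}} m)`. -/
noncomputable def D (k : ℕ) (η : Measure Conf) : Measure (Conf × BSeq) :=
  ∑ i ∈ Finset.range (2 ^ k), (η.map (shift^[i])).prod (lebesgue.restrict (cyl i k))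

/-- `ν` is a measure of periodic type `k`: `k` is the least number such that `ν = D_k[η]` for some
`η ∈ 𝓜_k`. -/
def IsPeriodicType (k : ℕ) (ν : Measure (Conf × BSeq)) : Prop :=
  IsLeast {j | ∃ η ∈ shiftInv j, ν = D j η} k

/-- `ν ∈ 𝕄` is aperiodic: it is not of periodic type `k` for any `k`. -/
def IsAperiodic (ν : Measure (Conf × BSeq)) : Prop :=
  ν ∈ prodInv ∧ ¬ ∃ k, IsPeriodicType k ν

/-- `ϱ_n = exp (2^{1-n} π i)`, a primitive root of unity of degree `2^n`. -/
noncomputable def rho (n : ℕ) : ℂ := Complex.exp (2 * Real.pi * Complex.I / 2 ^ n)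

/-- `f` is a coherent normalized system of dyadic eigenfunctions of the shift on `(I^ℤ, η)`:
`f_0 = 1`, `f_n = f_{n+1}^2` and `𝕊 f_n = ϱ_n f_n` almost everywhere. -/
structure IsEigenSystem (η : Measure Conf) (f : ℕ → Conf → ℂ) : Prop where
  measurable : ∀ n, Measurable (f n)
  zero : ∀ᵐ w ∂η, f 0 w = 1
  sq : ∀ n, ∀ᵐ w ∂η, f n w = f (n + 1) w ^ 2
  eigen : ∀ n, ∀ᵐ w ∂η, f n (shift w) = rho n * f n w

/-- The level set `B(r,n) = {f_n = ϱ_n^r}`. -/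
def levelSet (f : ℕ → Conf → ℂ) (r n : ℕ) : Set Conf := {w | f n w = rho n ^ r}

/-- `θ_n^{(α)}`: the normalized restriction of `η` to the set `B(r(n,α), n)`, where
`r(n,α) = ∑_{k<n} 2^k α_{k+1}`. -/
noncomputable def thetaAlpha (η : Measure Conf) (f : ℕ → Conf → ℂ) (α : BSeq) (n : ℕ) :
    Measure Conf :=
  ProbabilityTheory.cond η (levelSet f (digitSum n α) n)

/-- `ν = ν^{(α)}[η]`: `ν` is the measure in `𝕄` with `θ_n[ν] = θ_n^{(α)}` for all `n` (the
eigenfunctions `f` of `(I^ℤ, η)` being fixed). -/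
def IsNuAlpha (η : Measure Conf) (f : ℕ → Conf → ℂ) (α : BSeq) (ν : Measure (Conf × BSeq)) :
    Prop :=
  ν ∈ prodInv ∧ ∀ n, theta n ν = thetaAlpha η f α n

/-! ### The graph of ordered pairs, its path space and its central measures -/

/-- The vertices on floor `n` of the graph `OP` of ordered pairs. -/
def OP : ℕ → Type
  | 0 => Bool
  | n + 1 => OP n × OP n

/-- The beginning of the edge with index `b` entering the vertex `v = (v₀, v₁)`. -/
def OP.child {n : ℕ} (b : Bool) (v : OP (n + 1)) : OP n :=
  match b with
  | false => Prod.fst (α := OP n) (β := OP n) v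
  | true => Prod.snd (α := OP n) (β := OP n) v

/-- Every floor is a finite discrete space. -/
instance (n : ℕ) : MeasurableSpace (OP n) := ⊤

/-- The infinite paths `𝒯(OP)`: `vert n` is the vertex on floor `n`, and `edge n` is the index of
the edge from floor `n` to floor `n + 1` (an edge is given by its end and its index). -/
structure OPPath where
  vert : ∀ n, OP n
  edge : ℕ → Bool
  compat : ∀ n, vert n = OP.child (edge n) (vert (n + 1))

/-- The Borel σ-algebra of `𝒯(OP)`, generated by the cylinders. -/
instance : MeasurableSpace OPPath :=
  MeasurableSpace.comap (fun x : OPPath => (x.vert, x.edge)) inferInstance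

/-- `x` and `y` lie in the same element of the partition `ξ_n`: they coincide from floor `n` on. -/
def TailEqFrom (n : ℕ) (x y : OPPath) : Prop :=
  ∀ m, n ≤ m → x.vert m = y.vert m ∧ x.edge m = y.edge m

/-- A probability measure on `𝒯(OP)` is central if, for each `n`, the `2^n` beginnings of a path
with a fixed tail are equiprobable: the conditional measures on the elements of `ξ_n` are uniform.
(The paths with a fixed tail from floor `n` on are told apart by the indices of the first `n` edges,
which can be arbitrary; the events that depend on the tail only are the Borel unions of elements
of `ξ_n`.) -/
def IsCentral (μ : Measure OPPath) : Prop :=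
  IsProbabilityMeasure μ ∧
    ∀ (n : ℕ) (a b : Fin n → Bool) (B : Set OPPath), MeasurableSet B →
      (∀ x y, TailEqFrom n x y → (x ∈ B ↔ y ∈ B)) →
      μ (B ∩ {x | ∀ i : Fin n, x.edge i = a i}) = μ (B ∩ {x | ∀ i : Fin n, x.edge i = b i})

/-- The central measures that are ergodic: every Borel set which is invariant under the tail
equivalence relation is null or conull. -/
def centralErg : Set (Measure OPPath) :=
  {μ | IsCentral μ ∧ ∀ B : Set OPPath, MeasurableSet B →
    (∀ x y, (∃ n, TailEqFrom n x y) → (x ∈ B ↔ y ∈ B)) → μ B = 0 ∨ μ B = 1}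

/-- One step of redrawing a path downwards along edges with indices `e`. -/
def OP.descend (e : ℕ → Bool) (V : ∀ n, OP n) : ∀ n, OP n := fun n => OP.child (e n) (V (n + 1))

theorem OP.descend_iterate_succ (x : OPPath) (e : ℕ → Bool) (N : ℕ)
    (h : ∀ n, N ≤ n → e n = x.edge n) (k m : ℕ) (hm : N ≤ m + k) :
    (OP.descend e)^[k + 1] x.vert m = (OP.descend e)^[k] x.vert m := by
  induction k generalizing m with
  | zero =>
    change OP.child (e m) (x.vert (m + 1)) = x.vert m
    rw [h m (by omega), ← x.compat m]
  | succ k ih =>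
    have hk := ih (m + 1) (by omega)
    rw [Function.iterate_succ_apply'] at hk
    rw [Function.iterate_succ_apply', Function.iterate_succ_apply']
    exact congrArg (OP.child (e m)) hk

/-- The path that coincides with `x` from floor `N` on and whose edges have the indices `e`
(where `e` agrees with the indices of `x` from `N` on). -/
def OPPath.relabel (x : OPPath) (e : ℕ → Bool) (N : ℕ) (h : ∀ n, N ≤ n → e n = x.edge n) :
    OPPath where
  vert := (OP.descend e)^[N] x.vert
  edge := e
  compat n := by
    have := OP.descend_iterate_succ x e N h N n (by omega)
    rw [Function.iterate_succ_apply'] at this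
    exact this.symm

theorem odometer_tail (α : BSeq) (n : ℕ) (hn : α n = false) (m : ℕ) (hm : n + 1 ≤ m) :
    odometer α m = α m := by
  unfold odometer
  rw [if_neg]
  intro h
  have := h n (by omega)
  simp_all

theorem odometerInv_tail (α : BSeq) (n : ℕ) (hn : α n = true) (m : ℕ) (hm : n + 1 ≤ m) :
    odometerInv α m = α m := by
  unfold odometerInv
  rw [if_neg]
  intro h
  have := h n (by omega)
  simp_all

open Classical in
/-- The adic transformation: if the first edge of `x` with index `0` goes to floor `n + 1`, then the
new path coincides with `x` from floor `n + 1` on, enters that floor along the edge with index `1`,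
and its previous edges have index `0`. (Where the transformation is undefined, the value is `x`.) -/
noncomputable def adic (x : OPPath) : OPPath :=
  if h : ∃ n, x.edge n = false then
    x.relabel (odometer x.edge) (Nat.find h + 1) (odometer_tail x.edge _ (Nat.find_spec h))
  else x

open Classical in
/-- The inverse adic transformation, with the value `x` where it is undefined. -/
noncomputable def adicInv (x : OPPath) : OPPath :=
  if h : ∃ n, x.edge n = true then
    x.relabel (odometerInv x.edge) (Nat.find h + 1) (odometerInv_tail x.edge _ (Nat.find_spec h))
  else x

/-- The integer powers `𝒜^k` of the adic transformation (meant for paths on which all of them are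
defined, that is, with infinitely many edges of either index). -/
noncomputable def adicPow : ℤ → OPPath → OPPath
  | Int.ofNat k => adic^[k]
  | Int.negSucc k => adicInv^[k + 1]

/-- The map `𝒯(OP) → I^ℤ × I^ℕ` that conjugates the adic transformation to `𝕊 × 𝕆`: the second
component is the sequence of the indices of the edges of `x`, and the `k`-th coordinate of the first
component is the initial vertex (on floor `0`) of `𝒜^k x`. -/
noncomputable def coding (x : OPPath) : Conf × BSeq :=
  (fun k => (adicPow k x).vert 0, x.edge)

/-! ### Digits of binary sequences -/

/-! The residues modulo 2^n of the second coordinate map 𝕊 × 𝕆 onto a coherent tower of rotations of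
ℤ/2^n. A measure ν ∈ 𝕄 is determined by the conditional laws of its first coordinate given these
residues; the shift permutes these laws cyclically, so θ_n[ν] for large n suffices
(`eq_of_theta_eq`). If ν is ergodic, all these laws are ergodic under 𝕊^(2^n) (`ergodic_thetaAt`),
and ergodicity of θ_n[ν] for large n implies that of ν (`ergodic_of_theta`).

Let ν be ergodic. If θ_{n+1}[ν] = θ_n[ν] for some n, this law is invariant under U = 𝕊^(2^n) and
ergodic under U²; then it is ergodic under all higher powers U^(2^m) (`Ergodic.iterate_two_pow`),
and θ_m[ν] ≪ θ_n[ν] forces θ_m[ν] = θ_n[ν] for m > n, that is ν = D_n[θ_n[ν]]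
(`eq_D_of_theta_succ_eq`). If θ_{n+1}[ν] ≠ θ_n[ν], the 2^(n+1) laws over the residues are distinct
ergodic measures, hence mutually singular, so the residue is a function of the first coordinate
(`exists_label_of_theta_ne`). When this happens for every n, ν is carried by the graph of an
equivariant map to the odometer. Over an ergodic η, such a map differs from the residues given by
the eigenfunctions f_n by constants only, and these constants are the digits of α.

For periodic type k, the label at level k is the rotation factor on 2^k points, and a finer factor
would be constant almost everywhere for an 𝕊^(2^k)-invariant law. Conversely, the fibre measure of a
rotation factor that cannot be refined generates the required D_k (`ergodic_cond_or_exists`).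

A vertex on floor n is a word of length 2^n, and a path is a growing system of windows around the
origin, placed by the edge indices. Thus `decode` inverts `coding` wherever the windows exhaust ℤ,
which is almost everywhere. A tail class from floor n becomes a segment of 2^n consecutive points of
an orbit, so centrality means invariance along these segments; what is missed at their ends has mass
2^(-n). -/

theorem digitSum_succ (n : ℕ) (α : BSeq) :
    digitSum (n + 1) α = digitSum n α + (α n).toNat * 2 ^ n :=
  Finset.sum_range_succ _ _

theorem digitSum_lt (n : ℕ) (α : BSeq) : digitSum n α < 2 ^ n := by
  induction n with
  | zero => simp [digitSum]
  | succ n ih =>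
    rw [digitSum_succ, pow_succ]
    cases α n <;> simp <;> omega

theorem digitSum_congr {n : ℕ} {α β : BSeq} (h : ∀ i < n, α i = β i) :
    digitSum n α = digitSum n β :=
  Finset.sum_congr rfl fun i hi => by rw [h i (Finset.mem_range.1 hi)]

theorem digitSum_inj {n : ℕ} {α β : BSeq} (h : digitSum n α = digitSum n β) :
    ∀ i < n, α i = β i := by
  induction n with
  | zero => simp
  | succ n ih =>
    have ha := digitSum_lt n α
    have hb := digitSum_lt n β
    rw [digitSum_succ, digitSum_succ] at h
    have hn : α n = β n := by
      cases h1 : α n <;> cases h2 : β n <;> simp [h1, h2] at h ⊢ <;> omega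
    intro i hi
    rcases Nat.lt_succ_iff_lt_or_eq.1 hi with hi | rfl
    · exact ih (by rw [hn] at h; omega) i hi
    · exact hn

/-- The conditional term is the carry out of the first `n` digits. -/
theorem digitSum_odometer (n : ℕ) (α : BSeq) :
    digitSum n (odometer α) + (if ∀ j < n, α j = true then 2 ^ n else 0) = digitSum n α + 1 := by
  induction n with
  | zero => simp [digitSum]
  | succ n ih =>
    have key : (∀ j < n + 1, α j = true) ↔ (∀ j < n, α j = true) ∧ α n = true :=
      ⟨fun h => ⟨fun j hj => h j (by omega), h n (by omega)⟩, fun h j hj => by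
        rcases Nat.lt_succ_iff_lt_or_eq.1 hj with hj | rfl
        exacts [h.1 j hj, h.2]⟩
    rw [digitSum_succ, digitSum_succ]
    by_cases h : ∀ j < n, α j = true
    · have ho : odometer α n = !(α n) := by simp only [odometer]; rw [if_pos h]
      rw [if_pos h] at ih
      rw [ho]
      cases h1 : α n
      · rw [if_neg (by rw [key]; simp [h1])]; simp; omega
      · rw [if_pos (key.2 ⟨h, h1⟩)]; simp [pow_succ]; omega
    · have ho : odometer α n = α n := by simp only [odometer]; rw [if_neg h]
      rw [if_neg h] at ih
      rw [if_neg (by rw [key]; tauto), ho]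
      omega

theorem digitSum_not (n : ℕ) (α : BSeq) :
    digitSum n (fun i => !(α i)) + digitSum n α + 1 = 2 ^ n := by
  induction n with
  | zero => simp [digitSum]
  | succ n ih => rw [digitSum_succ, digitSum_succ, pow_succ]; cases α n <;> simp <;> omega

/-- The first `n` digits of `α`, as a residue modulo `2 ^ n`. -/
def digitClass (n : ℕ) (α : BSeq) : ZMod (2 ^ n) := (digitSum n α : ZMod (2 ^ n))

theorem digitClass_val (n : ℕ) (α : BSeq) : (digitClass n α).val = digitSum n α :=
  ZMod.val_cast_of_lt (digitSum_lt n α)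

theorem two_pow_eq_zero (n : ℕ) : (2 : ZMod (2 ^ n)) ^ n = 0 := by
  have := ZMod.natCast_self (2 ^ n)
  push_cast at this
  exact this

theorem digitClass_odometer (n : ℕ) (α : BSeq) :
    digitClass n (odometer α) = digitClass n α + 1 := by
  have := congrArg (Nat.cast : ℕ → ZMod (2 ^ n)) (digitSum_odometer n α)
  split_ifs at this <;> simpa [digitClass, two_pow_eq_zero] using this

theorem digitClass_not (n : ℕ) (α : BSeq) :
    digitClass n (fun i => !(α i)) = -1 - digitClass n α := by
  have := congrArg (Nat.cast : ℕ → ZMod (2 ^ n)) (digitSum_not n α)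
  simp only [Nat.cast_add, Nat.cast_one, CharP.cast_eq_zero] at this
  simp only [digitClass]
  linear_combination this

/-- Complementing all digits acts on residues as r ↦ -1 - r, which conjugates adding 1 to
subtracting 1. -/
theorem odometerInv_eq (α : BSeq) :
    odometerInv α = fun i => !(odometer (fun j => !(α j)) i) := by
  funext i
  simp only [odometerInv, odometer, Bool.not_eq_true']
  split_ifs <;> simp

theorem digitClass_odometerInv (n : ℕ) (α : BSeq) :
    digitClass n (odometerInv α) = digitClass n α - 1 := by
  rw [odometerInv_eq, digitClass_not, digitClass_odometer, digitClass_not]; ring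

/-- This embeds I^ℕ in the inverse limit of the groups ℤ/2^n, so that identities for the odometer
become ring identities. -/
theorem ext_digitClass {α β : BSeq} (h : ∀ n, digitClass n α = digitClass n β) : α = β := by
  funext i
  refine digitSum_inj (n := i + 1) ?_ i (by omega)
  rw [← digitClass_val, ← digitClass_val, h]

theorem odometer_odometerInv (α : BSeq) : odometer (odometerInv α) = α :=
  ext_digitClass fun n => by rw [digitClass_odometer, digitClass_odometerInv]; ring

theorem odometerInv_odometer (α : BSeq) : odometerInv (odometer α) = α :=
  ext_digitClass fun n => by rw [digitClass_odometerInv, digitClass_odometer]; ring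

/-- Reduction of residues modulo `2 ^ (n + 1)` to residues modulo `2 ^ n`. -/
def reduce (n : ℕ) : ZMod (2 ^ (n + 1)) →+* ZMod (2 ^ n) :=
  ZMod.castHom (pow_dvd_pow 2 n.le_succ) _

theorem reduce_digitClass (n : ℕ) (α : BSeq) :
    reduce n (digitClass (n + 1) α) = digitClass n α := by
  rw [digitClass, digitClass, map_natCast, digitSum_succ, Nat.cast_add, Nat.cast_mul,
    ZMod.natCast_self, mul_zero, add_zero]

theorem digitClass_zero_iff (n : ℕ) (α : BSeq) : α ∈ cyl 0 n ↔ digitClass n α = 0 := by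
  rw [← ZMod.val_eq_zero, digitClass_val]; rfl

/-- The binary sequence with prescribed residues of its beginnings. -/
def ofResidues (c : ∀ n, ZMod (2 ^ n)) : BSeq := fun i => (c (i + 1)).val.testBit i

/-- By coherence, `c (n + 1)` is `c n` plus 2^n times its own top binary digit, the one that
`ofResidues` keeps. -/
theorem digitClass_ofResidues {c : ∀ n, ZMod (2 ^ n)} (hc : ∀ n, reduce n (c (n + 1)) = c n)
    (n : ℕ) : digitClass n (ofResidues c) = c n := by
  induction n with
  | zero => exact Subsingleton.elim (α := ZMod 1) _ _
  | succ n ih =>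
    apply ZMod.val_injective
    rw [digitClass_val, digitSum_succ, ← digitClass_val, ih, ← hc n]
    have h1 : (reduce n (c (n + 1))).val = (c (n + 1)).val % 2 ^ n := by
      conv_lhs => rw [← ZMod.natCast_zmod_val (c (n + 1)), map_natCast]
      exact ZMod.val_natCast _ _
    have h2 : (c (n + 1)).val < 2 ^ (n + 1) := ZMod.val_lt _
    have h3 : (c (n + 1)).val / 2 ^ n < 2 := by
      rw [Nat.div_lt_iff_lt_mul (by positivity), ← pow_succ']; exact h2
    have h4 : (ofResidues c n).toNat = (c (n + 1)).val / 2 ^ n := by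
      simp only [ofResidues, Nat.testBit_eq_decide_div_mod_eq]
      interval_cases h : (c (n + 1)).val / 2 ^ n <;> simp
    rw [h1, h4, mul_comm]
    exact Nat.mod_add_div _ _

/-! ### Measurability -/

theorem measurable_digitSum (n : ℕ) : Measurable (digitSum n) := by
  unfold digitSum
  refine Finset.measurable_sum _ fun i _ => ?_
  exact (Measurable.of_discrete (f := fun b : Bool => b.toNat * 2 ^ i)).comp (measurable_pi_apply i)

theorem measurable_digitClass (n : ℕ) : Measurable (digitClass n) :=
  (Measurable.of_discrete (f := fun k : ℕ => (k : ZMod (2 ^ n)))).comp (measurable_digitSum n)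

theorem measurable_ofResidues {X : Type*} [MeasurableSpace X] {c : X → ∀ n, ZMod (2 ^ n)}
    (hc : ∀ n, Measurable fun x => c x n) : Measurable fun x => ofResidues (c x) :=
  measurable_pi_lambda _ fun i =>
    (Measurable.of_discrete (f := fun k : ZMod (2 ^ (i + 1)) => k.val.testBit i)).comp (hc (i + 1))

theorem measurable_of_digitClass {X : Type*} [MeasurableSpace X] {p : X → BSeq}
    (hp : ∀ n, Measurable fun x => digitClass n (p x)) : Measurable p := by
  convert! measurable_ofResidues hp with x
  exact ext_digitClass fun n => (digitClass_ofResidues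
    (c := fun n => digitClass n (p x)) (fun n => reduce_digitClass n _) n).symm

theorem measurable_odometer : Measurable odometer :=
  measurable_of_digitClass fun n => by
    simp only [digitClass_odometer]
    exact (Measurable.of_discrete (f := fun x => x + 1)).comp (measurable_digitClass n)

theorem measurable_odometerInv : Measurable odometerInv :=
  measurable_of_digitClass fun n => by
    simp only [digitClass_odometerInv]
    exact (Measurable.of_discrete (f := fun x => x - 1)).comp (measurable_digitClass n)

theorem measurable_shift : Measurable shift :=
  measurable_pi_lambda _ fun _ => measurable_pi_apply _

/-- The shift as a measurable equivalence. -/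
def shiftEquiv : Conf ≃ᵐ Conf where
  toFun := shift
  invFun w := fun n => w (n - 1)
  left_inv w := by funext n; simp [shift]
  right_inv w := by funext n; simp [shift]
  measurable_toFun := measurable_shift
  measurable_invFun := measurable_pi_lambda _ fun _ => measurable_pi_apply _

/-- The odometer as a measurable equivalence. -/
def odometerEquiv : BSeq ≃ᵐ BSeq where
  toFun := odometer
  invFun := odometerInv
  left_inv := odometerInv_odometer
  right_inv := odometer_odometerInv
  measurable_toFun := measurable_odometer
  measurable_invFun := measurable_odometerInv

/-- The product of the shift and the odometer as a measurable equivalence. -/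
def shiftOdometerEquiv : Conf × BSeq ≃ᵐ Conf × BSeq := shiftEquiv.prodCongr odometerEquiv

theorem measurable_shiftOdometer : Measurable shiftOdometer := shiftOdometerEquiv.measurable

theorem digitClass_odometer_iterate (n k : ℕ) (α : BSeq) :
    digitClass n (odometer^[k] α) = digitClass n α + k := by
  induction k with
  | zero => simp
  | succ k ih => rw [Function.iterate_succ_apply', digitClass_odometer, ih]; push_cast; ring

/-! ### Cyclic factors and ergodicity of powers -/

namespace CyclicFactor

open ProbabilityTheory Filter

/-- The case `a = 0` is the wrap-around of the cycle: it produces the return map `T^[N]` in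
`toFiber_map` and the use of invariance in `D_mem_prodInv`. -/
theorem val_sub_one {N : ℕ} [NeZero N] (a : ZMod N) :
    (a - 1).val + 1 = if a = 0 then N else a.val := by
  split_ifs with h
  · obtain ⟨n, rfl⟩ := Nat.exists_eq_succ_of_ne_zero (NeZero.ne N)
    rw [h, zero_sub, ZMod.val_neg_one]
  · have hv : a.val ≠ 0 := fun h' => h ((ZMod.val_eq_zero a).1 h')
    have hlt := ZMod.val_lt a
    have h2 : a - 1 = ((a.val - 1 : ℕ) : ZMod N) := by
      rw [Nat.cast_sub (by omega), ZMod.natCast_zmod_val]; simp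
    rw [h2, ZMod.val_cast_of_lt (by omega)]
    omega

variable {X : Type*} [MeasurableSpace X] {μ : Measure X} {T : X → X} {N : ℕ} {q : X → ZMod N}

theorem ae_iterate (hT : MeasurePreserving T μ μ) (h : ∀ᵐ x ∂μ, q (T x) = q x + 1) :
    ∀ᵐ x ∂μ, ∀ j : ℕ, q (T^[j] x) = q x + j := by
  refine ae_all_iff.2 fun j => ?_
  induction j with
  | zero => simp
  | succ j ih =>
    filter_upwards [ih, (hT.iterate j).quasiMeasurePreserving.ae h] with x h1 h2
    rw [Function.iterate_succ_apply', h2, h1]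
    push_cast; ring

theorem map_restrict_fiber (hT : MeasurePreserving T μ μ) (hq : Measurable q)
    (h : ∀ᵐ x ∂μ, q (T x) = q x + 1) (r : ZMod N) :
    (μ.restrict (q ⁻¹' {r})).map T = μ.restrict (q ⁻¹' {r + 1}) := by
  have := (hT.restrict_preimage (hq (measurableSet_singleton (r + 1)))).map_eq
  rw [← this]
  congr 1
  refine Measure.restrict_congr_set ?_
  filter_upwards [h] with x hx
  apply propext
  change q x = r ↔ q (T x) = r + 1
  rw [hx, add_left_inj]

theorem measure_fiber_eq (hT : MeasurePreserving T μ μ) (hq : Measurable q)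
    (h : ∀ᵐ x ∂μ, q (T x) = q x + 1) (r : ZMod N) : μ (q ⁻¹' {r + 1}) = μ (q ⁻¹' {r}) := by
  have := congrArg (fun ν => ν univ) (map_restrict_fiber hT hq h r)
  simp only [Measure.map_apply hT.measurable MeasurableSet.univ, preimage_univ] at this
  simpa using this.symm

theorem map_cond_fiber (hT : MeasurePreserving T μ μ) (hq : Measurable q)
    (h : ∀ᵐ x ∂μ, q (T x) = q x + 1) (r : ZMod N) :
    (cond μ (q ⁻¹' {r})).map T = cond μ (q ⁻¹' {r + 1}) := by
  rw [ProbabilityTheory.cond, ProbabilityTheory.cond, Measure.map_smul, map_restrict_fiber hT hq h, measure_fiber_eq hT hq h]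

theorem map_cond_fiber_iterate (hT : MeasurePreserving T μ μ) (hq : Measurable q)
    (h : ∀ᵐ x ∂μ, q (T x) = q x + 1) (r : ZMod N) (j : ℕ) :
    (cond μ (q ⁻¹' {r})).map (T^[j]) = cond μ (q ⁻¹' {r + j}) := by
  induction j with
  | zero => simp
  | succ j ih =>
    rw [Function.iterate_succ', ← Measure.map_map hT.measurable (hT.measurable.iterate j), ih,
      map_cond_fiber hT hq h]
    push_cast
    rw [add_assoc]

theorem measure_fiber_of_forall_eq [NeZero N] [IsProbabilityMeasure μ] (hq : Measurable q)
    (h : ∀ s, μ (q ⁻¹' {s}) = μ (q ⁻¹' {0})) (r : ZMod N) : μ (q ⁻¹' {r}) = (N : ENNReal)⁻¹ := by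
  have h2 : ∑ s : ZMod N, μ (q ⁻¹' {s}) = 1 := by
    rw [← measure_univ (μ := μ), ← preimage_univ (f := q), ← Finset.coe_univ]
    exact sum_measure_preimage_singleton _ fun s _ => hq (measurableSet_singleton s)
  simp only [h, Finset.sum_const, Finset.card_univ, ZMod.card, nsmul_eq_mul] at h2
  rw [h]
  exact ENNReal.eq_inv_of_mul_eq_one_left (by rwa [mul_comm])

theorem measure_fiber [NeZero N] [IsProbabilityMeasure μ] (hT : MeasurePreserving T μ μ)
    (hq : Measurable q) (h : ∀ᵐ x ∂μ, q (T x) = q x + 1) (r : ZMod N) :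
    μ (q ⁻¹' {r}) = (N : ENNReal)⁻¹ := by
  have h0 : ∀ j : ℕ, μ (q ⁻¹' {(j : ZMod N)}) = μ (q ⁻¹' {0}) := fun j => by
    induction j with
    | zero => simp
    | succ j ih => rw [Nat.cast_succ, measure_fiber_eq hT hq h, ih]
  refine measure_fiber_of_forall_eq hq (fun s => ?_) r
  rw [← h0 s.val, ZMod.natCast_zmod_val]

theorem measure_fiber_ne_zero [NeZero N] [IsProbabilityMeasure μ] (hT : MeasurePreserving T μ μ)
    (hq : Measurable q) (h : ∀ᵐ x ∂μ, q (T x) = q x + 1) (r : ZMod N) : μ (q ⁻¹' {r}) ≠ 0 := by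
  rw [measure_fiber hT hq h]
  exact ENNReal.inv_ne_zero.2 (ENNReal.natCast_ne_top N)

/-- An equivariant map to a cyclic group is automatically uniformly distributed. -/
theorem measurePreserving [NeZero N] [IsProbabilityMeasure μ] (hT : MeasurePreserving T μ μ)
    (hq : Measurable q) (h : ∀ᵐ x ∂μ, q (T x) = q x + 1) :
    MeasurePreserving q μ (PMF.uniformOfFintype (ZMod N)).toMeasure := by
  refine ⟨hq, Measure.ext_of_singleton fun r => ?_⟩
  rw [Measure.map_apply hq (measurableSet_singleton r), measure_fiber hT hq h,
    PMF.toMeasure_apply_singleton _ _ (measurableSet_singleton r), PMF.uniformOfFintype_apply,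
    ZMod.card]

/-- The first point on the orbit of `x` (from `x` on) that lies in the fibre over `r`. -/
def toFiber {X : Type*} {N : ℕ} (T : X → X) (q : X → ZMod N) (r : ZMod N) (x : X) : X := T^[(r - q x).val] x

/-- The next visit to the fibre does not change along the orbit until the fibre is left; then it
moves on by a full cycle. -/
theorem toFiber_map {X : Type*} {T : X → X} {N : ℕ} {q : X → ZMod N} [NeZero N] {x : X} (h : q (T x) = q x + 1) (r : ZMod N) :
    toFiber T q r (T x) = if q x = r then T^[N] x else toFiber T q r x := by
  have h1 := val_sub_one (r - q x)
  have h2 : r - q (T x) = r - q x - 1 := by rw [h]; ring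
  rw [toFiber, ← Function.iterate_succ_apply, Nat.succ_eq_add_one, h2, h1]
  by_cases h3 : q x = r
  · rw [if_pos h3, if_pos (by rw [h3, sub_self])]
  · rw [if_neg h3, if_neg (by rwa [sub_eq_zero, eq_comm]), toFiber]

theorem toFiber_of_mem {X : Type*} {T : X → X} {N : ℕ} {q : X → ZMod N} {x : X} {r : ZMod N} (h : q x = r) : toFiber T q r x = x := by
  simp [toFiber, h]

theorem measurable_toFiber [NeZero N] (hT : Measurable T) (hq : Measurable q) (r : ZMod N) :
    Measurable (toFiber T q r) := by
  have : Countable (ZMod N) := Finite.to_countable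
  have h : Measurable fun p : X × ZMod N => T^[(r - p.2).val] p.1 :=
    measurable_from_prod_countable_left fun s => hT.iterate (r - s).val
  exact h.comp (measurable_id.prodMk hq)

/-- The point `toFiber T q r x` is one of countably many iterates of `x`, and each iterate pulls
null sets back to null sets. -/
theorem ae_toFiber [NeZero N] (hT : MeasurePreserving T μ μ) (hq : Measurable q)
    (h : ∀ᵐ x ∂μ, q (T x) = q x + 1) {r : ZMod N} {P : X → Prop} [IsProbabilityMeasure μ]
    (hP : ∀ᵐ x ∂cond μ (q ⁻¹' {r}), P x) : ∀ᵐ x ∂μ, P (toFiber T q r x) := by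
  have h1 : ∀ᵐ x ∂μ, q x = r → P x := by
    have := hP
    rw [ProbabilityTheory.cond, Measure.ae_ennreal_smul_measure_eq
      (ENNReal.inv_ne_zero.2 (measure_ne_top μ _))] at this
    exact (ae_restrict_iff' (hq (measurableSet_singleton r))).1 this
  have h2 : ∀ᵐ x ∂μ, ∀ j : ℕ, q (T^[j] x) = r → P (T^[j] x) :=
    ae_all_iff.2 fun j => (hT.iterate j).quasiMeasurePreserving.ae h1
  filter_upwards [h2, ae_iterate hT h] with x h3 h4
  exact h3 _ (by rw [h4, ZMod.natCast_zmod_val]; ring)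

theorem measurePreserving_cond [IsProbabilityMeasure μ] (hT : MeasurePreserving T μ μ)
    (hq : Measurable q) (h : ∀ᵐ x ∂μ, q (T x) = q x + 1) (r : ZMod N) :
    MeasurePreserving T^[N] (cond μ (q ⁻¹' {r})) (cond μ (q ⁻¹' {r})) :=
  ⟨hT.measurable.iterate N, by rw [map_cond_fiber_iterate hT hq h]; simp⟩

/-- The first return to a fibre of a cyclic factor of an ergodic system is ergodic. -/
theorem ergodic_cond [NeZero N] [IsProbabilityMeasure μ] (hT : Ergodic T μ)
    (hq : Measurable q) (h : ∀ᵐ x ∂μ, q (T x) = q x + 1) (r : ZMod N) :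
    Ergodic T^[N] (cond μ (q ⁻¹' {r})) := by
  have hm := hT.toMeasurePreserving
  refine ⟨measurePreserving_cond hm hq h r, ⟨fun E hE hEi => ?_⟩⟩
  rw [eventuallyConst_set]
  -- The `T^[N]`-invariant set `E` is spread from the fibre over the whole space; the result is
  -- `T`-invariant modulo null sets, so ergodicity of `T` applies.
  have hC : MeasurableSet (toFiber T q r ⁻¹' E) := measurable_toFiber hm.measurable hq r hE
  have hCi : T ⁻¹' (toFiber T q r ⁻¹' E) =ᵐ[μ] toFiber T q r ⁻¹' E := by
    filter_upwards [h] with x hx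
    apply propext
    change toFiber T q r (T x) ∈ E ↔ toFiber T q r x ∈ E
    rw [toFiber_map hx]
    split_ifs with hr
    · rw [toFiber_of_mem hr]
      exact (Set.ext_iff.1 hEi x)
    · rfl
  have hmem := ae_cond_mem (μ := μ) (hq (measurableSet_singleton r))
  rcases hT.quasiErgodic.ae_mem_or_ae_notMem₀ hC.nullMeasurableSet hCi with h1 | h1
  · left
    filter_upwards [hmem, cond_absolutelyContinuous.ae_le h1] with x h2 h3
    rwa [mem_preimage, toFiber_of_mem h2] at h3
  · right
    filter_upwards [hmem, cond_absolutelyContinuous.ae_le h1] with x h2 h3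
    rwa [mem_preimage, toFiber_of_mem h2] at h3

end CyclicFactor

/-! ### Ergodicity of the powers 2^m and singularity of ergodic measures -/

section Powers

open Filter

variable {X : Type*} [MeasurableSpace X] {μ : Measure X} {T : X → X}

/-- A set which is invariant under the square of an ergodic transformation is trivial or a
fundamental domain for the transformation. -/
theorem Ergodic.of_sq_invariant (hT : Ergodic T μ) {B : Set X} (hB : MeasurableSet B)
    (hBi : (T^[2]) ⁻¹' B = B) :
    (∀ᵐ x ∂μ, x ∈ B) ∨ (∀ᵐ x ∂μ, x ∉ B) ∨ ∀ᵐ x ∂μ, T x ∈ B ↔ x ∉ B := by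
  have hBi' : ∀ x, T (T x) ∈ B ↔ x ∈ B := fun x => Set.ext_iff.1 hBi x
  have h1 := hT.ae_mem_or_ae_notMem (hB.inter (hT.measurable hB)) (by
    ext x; simp only [mem_preimage, mem_inter_iff, hBi']; tauto)
  have h2 := hT.ae_mem_or_ae_notMem (hB.union (hT.measurable hB)) (by
    ext x; simp only [mem_preimage, mem_union, hBi']; tauto)
  rcases h1 with h1 | h1
  · exact Or.inl (h1.mono fun x hx => hx.1)
  rcases h2 with h2 | h2
  · refine Or.inr (Or.inr ?_)
    filter_upwards [h1, h2] with x h3 h4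
    simp only [mem_inter_iff, mem_preimage, mem_union] at h3 h4
    tauto
  · exact Or.inr (Or.inl (h2.mono fun x hx h3 => hx (Or.inl h3)))

/-- Otherwise `T^[2]` exchanges some `B` with its complement. The trichotomy for `T^[2]`, applied to
`B` ∩ T⁻¹`B`, then makes `B` conull, null or `T`-invariant modulo null sets, and the last
contradicts the exchange. -/
theorem Ergodic.iterate_four (hT : MeasurePreserving T μ μ) (h2 : Ergodic T^[2] μ) :
    Ergodic T^[4] μ := by
  refine ⟨hT.iterate 4, ⟨fun B hB hBi => eventuallyConst_set.2 ?_⟩⟩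
  have hBi' : ∀ x, T (T (T (T x))) ∈ B ↔ x ∈ B := fun x => Set.ext_iff.1 hBi x
  have pull : ∀ {P : X → Prop}, (∀ᵐ x ∂μ, P x) → ∀ᵐ x ∂μ, P (T x) :=
    fun h => hT.quasiMeasurePreserving.ae h
  rcases h2.of_sq_invariant hB (by rw [← Function.iterate_mul]; exact hBi) with h | h | h
  · exact Or.inl h
  · exact Or.inr h
  have hC := h2.of_sq_invariant (hB.inter (hT.measurable hB)) (by
    ext x; simp only [mem_preimage, mem_inter_iff, Function.iterate_succ, Function.iterate_zero,
      Function.comp_apply, id, hBi'])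
  simp only [mem_preimage, mem_inter_iff, Function.iterate_succ, Function.iterate_zero,
      Function.comp_apply, id] at hC h
  rcases hC with h3 | h3 | h3
  · exact Or.inl (h3.mono fun x hx => hx.1)
  · right
    have h4 : ∀ᵐ x ∂μ, T x ∉ B := by
      filter_upwards [h3, pull h3, h] with x a b c
      tauto
    filter_upwards [pull (pull (pull h4))] with x a
    rwa [hBi'] at a
  · left
    have h4 : ∀ᵐ x ∂μ, T x ∈ B ↔ x ∈ B := by
      filter_upwards [h3, h, pull h] with x a b c
      tauto
    filter_upwards [h4, pull h4, h] with x a b c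
    tauto

theorem Ergodic.iterate_two_pow (hT : MeasurePreserving T μ μ) (h2 : Ergodic T^[2] μ) (m : ℕ) :
    Ergodic T^[2 ^ (m + 1)] μ := by
  induction m with
  | zero => exact h2
  | succ m ih =>
    have h : Ergodic ((T^[2 ^ m])^[2]) μ := by rwa [← Function.iterate_mul, ← pow_succ]
    have := Ergodic.iterate_four (hT.iterate (2 ^ m)) h
    rwa [← Function.iterate_mul, show 2 ^ m * 4 = 2 ^ (m + 1 + 1) by ring] at this

/-- Distinct ergodic probability measures of a transformation are mutually singular. -/
theorem Ergodic.mutuallySingular_of_ne {ν : Measure X} [IsProbabilityMeasure μ]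
    [IsProbabilityMeasure ν] (hμ : Ergodic T μ) (hν : Ergodic T ν) (hne : μ ≠ ν) :
    Measure.MutuallySingular μ ν := by
  -- The absolutely continuous part of `ν` with respect to `μ` is invariant, hence a multiple of the
  -- ergodic `μ`. A nonzero multiple would give `μ ≪ ν`, and then `μ = ν`.
  have h1 := hν.toMeasurePreserving.withDensity_rnDeriv hμ.toMeasurePreserving
  have hle : μ.withDensity (ν.rnDeriv μ) ≤ ν := Measure.withDensity_rnDeriv_le ν μ
  have : IsFiniteMeasure (μ.withDensity (ν.rnDeriv μ)) := isFiniteMeasure_of_le ν hle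
  obtain ⟨c, hc⟩ := hμ.eq_smul_of_absolutelyContinuous h1 (withDensity_absolutelyContinuous _ _)
  rcases eq_or_ne c 0 with rfl | hc0
  · rw [zero_smul] at hc
    have h2 := Measure.rnDeriv_add_singularPart ν μ
    rw [hc, zero_add] at h2
    rw [← h2]
    exact (Measure.mutuallySingular_singularPart ν μ).symm
  · refine absurd (hν.eq_of_absolutelyContinuous hμ.toMeasurePreserving ?_) hne
    rw [hc] at hle
    exact (Measure.absolutelyContinuous_smul hc0).trans (Measure.absolutelyContinuous_of_le hle)

end Powers

namespace CyclicFactor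

open ProbabilityTheory Filter

variable {X : Type*} [MeasurableSpace X] {μ : Measure X} {T : X → X} {k : ℕ}
  {q : X → ZMod (2 ^ k)}

/-- If the square of the first return to a fibre is not ergodic, the cyclic factor can be
refined. -/
theorem ergodic_cond_or_exists [IsProbabilityMeasure μ] (hT : Ergodic T μ) (hq : Measurable q)
    (h : ∀ᵐ x ∂μ, q (T x) = q x + 1) :
    Ergodic T^[2 ^ (k + 1)] (cond μ (q ⁻¹' {0})) ∨
      ∃ q' : X → ZMod (2 ^ (k + 1)), Measurable q' ∧ ∀ᵐ x ∂μ, q' (T x) = q' x + 1 := by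
  classical
  have hm := hT.toMeasurePreserving
  have hU := ergodic_cond hT hq h 0
  refine or_iff_not_imp_left.2 fun hne => ?_
  -- The return map is ergodic on the fibre and its square is not, so the trichotomy leaves only a
  -- set exchanged with its complement.
  have hB : ∃ B, MeasurableSet B ∧ ∀ᵐ x ∂cond μ (q ⁻¹' {0}), T^[2 ^ k] x ∈ B ↔ x ∉ B := by
    by_contra hcon
    simp only [not_exists, not_and] at hcon
    refine hne ?_
    rw [pow_succ, Function.iterate_mul]
    refine ⟨hU.toMeasurePreserving.iterate 2, ⟨fun B hB hBi => eventuallyConst_set.2 ?_⟩⟩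
    rcases hU.of_sq_invariant hB hBi with h1 | h1 | h1
    · exact Or.inl h1
    · exact Or.inr h1
    · exact absurd h1 (hcon B hB)
  obtain ⟨B, hB, hBi⟩ := hB
  -- The refined residue is `c` minus the waiting time for the fibre over 0. The waiting time drops
  -- by 1 at each step, except on leaving that fibre, where it jumps from 0 to 2^k - 1; exactly then
  -- `c` changes by 2^k and compensates.
  let c : X → ZMod (2 ^ (k + 1)) := fun x =>
    if toFiber T q 0 x ∈ B then 0 else ((2 ^ k : ℕ) : ZMod (2 ^ (k + 1)))
  have h2 : ((2 ^ k : ℕ) : ZMod (2 ^ (k + 1))) + ((2 ^ k : ℕ) : ZMod (2 ^ (k + 1))) = 0 := by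
    rw [← Nat.cast_add, ← two_mul, ← pow_succ', ZMod.natCast_self]
  refine ⟨fun x => c x - ((0 - q x).val : ZMod (2 ^ (k + 1))), ?_, ?_⟩
  · refine Measurable.sub ?_ ?_
    · exact Measurable.ite (measurable_toFiber hm.measurable hq 0 hB) measurable_const
        measurable_const
    · exact (Measurable.of_discrete
        (f := fun s : ZMod (2 ^ k) => ((0 - s).val : ZMod (2 ^ (k + 1))))).comp hq
  · filter_upwards [h, ae_toFiber hm hq h hBi] with x hx hxB
    have h3 := toFiber_map hx 0
    have h4 := val_sub_one (0 - q x)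
    have h5 : 0 - q (T x) = 0 - q x - 1 := by rw [hx]; ring
    have h6 := congrArg (Nat.cast : ℕ → ZMod (2 ^ (k + 1))) h4
    rw [Nat.cast_add, Nat.cast_one] at h6
    simp only [c]
    rw [h5, h3]
    by_cases h0 : q x = 0
    · rw [if_pos (by rw [h0, sub_zero])] at h6
      rw [if_pos h0]
      rw [toFiber_of_mem h0] at hxB ⊢
      have h7 : ((0 - q x).val : ZMod (2 ^ (k + 1))) = 0 := by simp [h0]
      rw [h7]
      by_cases hxb : x ∈ B
      · rw [if_neg (by tauto), if_pos hxb]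
        linear_combination -h6
      · rw [if_pos (by tauto), if_neg hxb]
        linear_combination -h6 - h2
    · rw [if_neg (by rwa [zero_sub, neg_eq_zero])] at h6
      rw [if_neg h0]
      linear_combination -h6

end CyclicFactor

/-! ### The measure `m` and the residues of the second coordinate -/

instance : IsProbabilityMeasure lebesgue := by unfold lebesgue; infer_instance

theorem exists_digitClass_eq (n : ℕ) (r : ZMod (2 ^ n)) : ∃ α, digitClass n α = r := by
  refine ⟨odometer^[r.val] fun _ => false, ?_⟩
  rw [digitClass_odometer_iterate]
  simp [digitClass, digitSum]

theorem apply_eq_of_digitClass_eq {n : ℕ} {α β : BSeq} (h : digitClass n α = digitClass n β)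
    {i : ℕ} (hi : i < n) : α i = β i :=
  digitSum_inj (by rw [← digitClass_val, ← digitClass_val, h]) i hi

theorem digitClass_eq_of_le {n m : ℕ} (hnm : n ≤ m) {α β : BSeq}
    (h : digitClass m α = digitClass m β) : digitClass n α = digitClass n β := by
  rw [digitClass, digitClass,
    digitSum_congr fun i hi => apply_eq_of_digitClass_eq h (hi.trans_le hnm)]

theorem digitSum_mod {n m : ℕ} (hnm : n ≤ m) (α : BSeq) :
    digitSum m α % 2 ^ n = digitSum n α := by
  induction m, hnm using Nat.le_induction with
  | base => exact Nat.mod_eq_of_lt (digitSum_lt n α)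
  | succ m hm ih =>
    rw [digitSum_succ, Nat.add_mod, ih]
    obtain ⟨c, hc⟩ := pow_dvd_pow 2 hm
    rw [hc, mul_left_comm, Nat.mul_mod_right, add_zero, Nat.mod_eq_of_lt (digitSum_lt n α)]

theorem lebesgue_fiber (n : ℕ) (r : ZMod (2 ^ n)) :
    lebesgue (digitClass n ⁻¹' {r}) = ((2 ^ n : ℕ) : ENNReal)⁻¹ := by
  obtain ⟨β, rfl⟩ := exists_digitClass_eq n r
  have h : digitClass n ⁻¹' {digitClass n β} = Set.pi (Finset.range n) fun i => {β i} := by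
    ext α
    simp only [mem_preimage, mem_singleton_iff, Set.mem_pi, Finset.coe_range, mem_Iio]
    refine ⟨fun h i hi => apply_eq_of_digitClass_eq h hi, fun h => ?_⟩
    rw [digitClass, digitClass, digitSum_congr h]
  rw [h, lebesgue, Measure.infinitePi_pi _ fun i _ => measurableSet_singleton _]
  have : ∀ b : Bool, (PMF.uniformOfFintype Bool).toMeasure {b} = 2⁻¹ := fun b => by
    rw [PMF.toMeasure_apply_singleton _ _ (measurableSet_singleton b)]
    simp
  simp [this, ENNReal.inv_pow]

/-- Finite measures on `I^ℕ` are determined by the distributions of the residues. -/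
theorem measure_ext_digitClass {μ ν : Measure BSeq} [IsFiniteMeasure μ] [IsFiniteMeasure ν] (N : ℕ)
    (h : ∀ n ≥ N, ∀ r, μ (digitClass n ⁻¹' {r}) = ν (digitClass n ⁻¹' {r})) : μ = ν := by
  have hmap : ∀ n ≥ N, μ.map (digitClass n) = ν.map (digitClass n) := fun n hn =>
    Measure.ext_of_singleton fun r => by
      rw [Measure.map_apply (measurable_digitClass n) (measurableSet_singleton r),
        Measure.map_apply (measurable_digitClass n) (measurableSet_singleton r), h n hn]
  refine IsProjectiveLimit.unique (P := fun I => ν.map I.restrict) (fun I => ?_) fun I => rfl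
  obtain ⟨n, hnN, hn⟩ : ∃ n ≥ N, ∀ i ∈ I, i < n :=
    ⟨N + I.sup id + 1, by omega, fun i hi => by
      have : i ≤ I.sup id := Finset.le_sup (f := id) hi
      omega⟩
  -- Restriction to the finitely many coordinates in `I` factors through the residue modulo 2^n,
  -- with `s` choosing a representative of each residue.
  choose s hs using exists_digitClass_eq n
  have hF : I.restrict = (fun r => I.restrict (s r)) ∘ digitClass n := by
    funext α
    ext i
    exact (apply_eq_of_digitClass_eq (hs (digitClass n α)) (hn i i.2)).symm
  rw [hF, ← Measure.map_map Measurable.of_discrete (measurable_digitClass n), hmap n hnN,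
    Measure.map_map Measurable.of_discrete (measurable_digitClass n), ← hF]

/-- An equivariant map to the odometer automatically preserves the measure. -/
theorem measurePreserving_of_odometer {X : Type*} [MeasurableSpace X] {μ : Measure X}
    [IsProbabilityMeasure μ] {T : X → X} (hT : MeasurePreserving T μ μ) {p : X → BSeq}
    (hp : Measurable p) (h : ∀ᵐ x ∂μ, p (T x) = odometer (p x)) :
    MeasurePreserving p μ lebesgue := by
  refine ⟨hp, ?_⟩
  have := Measure.isProbabilityMeasure_map (μ := μ) hp.aemeasurable
  refine measure_ext_digitClass 0 fun n _ r => ?_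
  rw [lebesgue_fiber, Measure.map_apply hp (measurable_digitClass n (measurableSet_singleton r)),
    ← preimage_comp, CyclicFactor.measure_fiber hT ((measurable_digitClass n).comp hp)]
  filter_upwards [h] with x hx
  rw [Function.comp_apply, hx, digitClass_odometer, Function.comp_apply]

/-- The residue modulo `2 ^ n` of the second coordinate. -/
def residue (n : ℕ) (x : Conf × BSeq) : ZMod (2 ^ n) := digitClass n x.2

theorem measurable_residue (n : ℕ) : Measurable (residue n) :=
  (measurable_digitClass n).comp measurable_snd

theorem measurableSet_residue (n : ℕ) (r : ZMod (2 ^ n)) : MeasurableSet (residue n ⁻¹' {r}) :=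
  measurable_residue n (measurableSet_singleton r)

theorem residue_shiftOdometer (n : ℕ) (x : Conf × BSeq) :
    residue n (shiftOdometer x) = residue n x + 1 := digitClass_odometer n x.2

theorem prod_measure_ext {μ ν : Measure (Conf × BSeq)} [IsFiniteMeasure μ] [IsFiniteMeasure ν]
    (N : ℕ) (h : ∀ n ≥ N, ∀ r, ∀ E, MeasurableSet E →
      μ (Prod.fst ⁻¹' E ∩ residue n ⁻¹' {r}) = ν (Prod.fst ⁻¹' E ∩ residue n ⁻¹' {r})) :
    μ = ν := by
  refine Measure.ext_prod fun {E F} hE hF => ?_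
  have hE' : MeasurableSet (Prod.fst ⁻¹' E : Set (Conf × BSeq)) := measurable_fst hE
  have key : (μ.restrict (Prod.fst ⁻¹' E)).map Prod.snd =
      (ν.restrict (Prod.fst ⁻¹' E)).map Prod.snd := by
    refine measure_ext_digitClass N fun n hn r => ?_
    have hr := measurable_digitClass n (measurableSet_singleton r)
    rw [Measure.map_apply measurable_snd hr, Measure.map_apply measurable_snd hr,
      Measure.restrict_apply (measurable_snd hr), Measure.restrict_apply (measurable_snd hr),
      inter_comm]
    exact h n hn r E hE
  have := congrArg (fun m => m F) key
  simp only [Measure.map_apply measurable_snd hF,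
    Measure.restrict_apply (measurable_snd (α := Conf) hF)] at this
  rwa [prod_eq, inter_comm]

/-- The normalized projection to `I^ℤ` of the restriction of `ν` to the set of points whose second
coordinate has the residue `r` modulo `2 ^ n`. -/
noncomputable def thetaAt (n : ℕ) (r : ZMod (2 ^ n)) (ν : Measure (Conf × BSeq)) : Measure Conf :=
  proj (ProbabilityTheory.cond ν (residue n ⁻¹' {r}))

theorem theta_eq_thetaAt (n : ℕ) (ν : Measure (Conf × BSeq)) : theta n ν = thetaAt n 0 ν := by
  have : (univ ×ˢ cyl 0 n : Set (Conf × BSeq)) = residue n ⁻¹' {0} := by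
    ext x
    simp only [mem_prod, mem_univ, true_and, digitClass_zero_iff]
    rfl
  rw [theta, thetaAt, this]

theorem semiconj_fst : Function.Semiconj Prod.fst shiftOdometer shift := fun _ => rfl

/-! ### Conditional laws of the first coordinate over the residues -/

section Theta

variable {ν : Measure (Conf × BSeq)} {n : ℕ}

theorem ae_residue (n : ℕ) (ν : Measure (Conf × BSeq)) :
    ∀ᵐ x ∂ν, residue n (shiftOdometer x) = residue n x + 1 :=
  Filter.Eventually.of_forall (residue_shiftOdometer n)

theorem measure_residue (hν : ν ∈ prodInv) (r : ZMod (2 ^ n)) :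
    ν (residue n ⁻¹' {r}) = ((2 ^ n : ℕ) : ENNReal)⁻¹ :=
  have := hν.2
  CyclicFactor.measure_fiber hν.1 (measurable_residue n) (ae_residue n ν) r

theorem thetaAt_apply (hν : ν ∈ prodInv) (r : ZMod (2 ^ n)) {E : Set Conf} (hE : MeasurableSet E) :
    thetaAt n r ν E = (2 ^ n : ℕ) * ν (Prod.fst ⁻¹' E ∩ residue n ⁻¹' {r}) := by
  rw [thetaAt, proj, Measure.map_apply measurable_fst hE,
    ProbabilityTheory.cond_apply (measurableSet_residue n r), measure_residue hν, inv_inv,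
    inter_comm]

theorem isProbabilityMeasure_thetaAt (hν : ν ∈ prodInv) (r : ZMod (2 ^ n)) :
    IsProbabilityMeasure (thetaAt n r ν) := by
  have := hν.2
  have := ProbabilityTheory.cond_isProbabilityMeasure
    (CyclicFactor.measure_fiber_ne_zero hν.1 (measurable_residue n) (ae_residue n ν) r)
  exact Measure.isProbabilityMeasure_map measurable_fst.aemeasurable

theorem map_shift_thetaAt (hν : ν ∈ prodInv) (r : ZMod (2 ^ n)) (j : ℕ) :
    (thetaAt n r ν).map shift^[j] = thetaAt n (r + j) ν := by
  have := hν.2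
  rw [thetaAt, thetaAt, ← CyclicFactor.map_cond_fiber_iterate hν.1 (measurable_residue n)
    (ae_residue n ν), proj, proj, Measure.map_map (measurable_shift.iterate j) measurable_fst,
    Measure.map_map measurable_fst (measurable_shiftOdometer.iterate j),
    (semiconj_fst.iterate_right j).comp_eq]

theorem measurePreserving_thetaAt (hν : ν ∈ prodInv) (r : ZMod (2 ^ n)) :
    MeasurePreserving shift^[2 ^ n] (thetaAt n r ν) (thetaAt n r ν) :=
  ⟨measurable_shift.iterate _, by rw [map_shift_thetaAt hν]; simp⟩

theorem theta_mem_shiftInv (hν : ν ∈ prodInv) (n : ℕ) : theta n ν ∈ shiftInv n := by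
  rw [theta_eq_thetaAt]
  exact ⟨measurePreserving_thetaAt hν 0, isProbabilityMeasure_thetaAt hν 0⟩

theorem prodErg_subset_prodInv : prodErg ⊆ prodInv := fun _ h => ⟨h.1.toMeasurePreserving, h.2⟩

theorem ergodic_thetaAt (hν : ν ∈ prodErg) (r : ZMod (2 ^ n)) :
    Ergodic shift^[2 ^ n] (thetaAt n r ν) := by
  have := hν.2
  have h := CyclicFactor.ergodic_cond hν.1 (measurable_residue n) (ae_residue n ν) r
  exact (measurable_fst.measurePreserving _).ergodic_of_ergodic_semiconj h
    (measurable_shift.iterate _) (semiconj_fst.iterate_right _)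

theorem proj_mem_shiftErg (hν : ν ∈ prodErg) : proj ν ∈ shiftErg := by
  have := hν.2
  exact ⟨(measurable_fst.measurePreserving _).ergodic_of_ergodic_semiconj hν.1
    measurable_shift semiconj_fst, Measure.isProbabilityMeasure_map measurable_fst.aemeasurable⟩

/-- The measures in `𝕄` are determined by their projections `θ_n`. -/
theorem eq_of_theta_eq {ν' : Measure (Conf × BSeq)} (hν : ν ∈ prodInv) (hν' : ν' ∈ prodInv) (N : ℕ)
    (h : ∀ n ≥ N, theta n ν = theta n ν') : ν = ν' := by
  have := hν.2
  have := hν'.2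
  refine prod_measure_ext N fun n hn r E hE => ?_
  have h1 : thetaAt n r ν = thetaAt n r ν' := by
    have h2 := congrArg (fun μ => μ.map shift^[r.val]) (h n hn)
    simpa [theta_eq_thetaAt, map_shift_thetaAt hν, map_shift_thetaAt hν'] using h2
  have h3 := congrArg (fun μ => μ E) h1
  simp only [thetaAt_apply hν _ hE, thetaAt_apply hν' _ hE] at h3
  exact (ENNReal.mul_right_inj (by positivity) (ENNReal.natCast_ne_top _)).1 h3

theorem thetaAt_absolutelyContinuous {ν' : Measure (Conf × BSeq)} (hν : ν ∈ prodInv)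
    (hν' : ν' ∈ prodInv) (h : ν' ≪ ν) (r : ZMod (2 ^ n)) : thetaAt n r ν' ≪ thetaAt n r ν := by
  refine Measure.AbsolutelyContinuous.mk fun E hE h0 => ?_
  rw [thetaAt_apply hν r hE, mul_eq_zero] at h0
  rw [thetaAt_apply hν' r hE, h (h0.resolve_left (by positivity)), mul_zero]

theorem theta_absolutelyContinuous_of_le (hν : ν ∈ prodInv) {m : ℕ} (hnm : n ≤ m) :
    theta m ν ≪ theta n ν := by
  rw [theta_eq_thetaAt, theta_eq_thetaAt]
  refine Measure.AbsolutelyContinuous.mk fun E hE h0 => ?_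
  rw [thetaAt_apply hν 0 hE, mul_eq_zero] at h0
  rw [thetaAt_apply hν 0 hE, mul_eq_zero]
  refine Or.inr (measure_mono_null (inter_subset_inter_right _ fun x hx => ?_)
    (h0.resolve_left (by positivity)))
  have h1 : ∀ k, digitClass k (fun _ => false) = 0 := fun k => by simp [digitClass, digitSum]
  have hx' : digitClass m x.2 = digitClass m (fun _ => false) := by rw [h1]; exact hx
  exact (digitClass_eq_of_le hnm hx').trans (h1 n)

/-- A measure in `𝕄` is ergodic if its projections `θ_n` are ergodic. -/
theorem ergodic_of_theta (hν : ν ∈ prodInv) (N : ℕ)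
    (h : ∀ n ≥ N, Ergodic shift^[2 ^ n] (theta n ν)) : ν ∈ prodErg := by
  have := hν.2
  refine ⟨⟨hν.1, ⟨fun C hC hCi => ?_⟩⟩, hν.2⟩
  rw [Filter.eventuallyConst_set]
  by_cases h0 : ν C = 0
  · exact Or.inr (measure_eq_zero_iff_ae_notMem.1 h0)
  left
  -- Conditioning `ν` on an invariant set of positive measure stays in 𝕄 and has projections θ_n
  -- absolutely continuous with respect to those of `ν`. Their ergodicity forces equality, so `ν` is
  -- concentrated on `C`.
  have hc : ProbabilityTheory.cond ν C ∈ prodInv := by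
    refine ⟨?_, ProbabilityTheory.cond_isProbabilityMeasure h0⟩
    have := (hν.1.restrict_preimage hC).smul_measure (ν C)⁻¹
    rwa [hCi] at this
  have heq : ProbabilityTheory.cond ν C = ν := by
    refine eq_of_theta_eq hc hν N fun n hn => ?_
    have := (theta_mem_shiftInv hc n).2
    have := (theta_mem_shiftInv hν n).2
    refine (h n hn).eq_of_absolutelyContinuous (theta_mem_shiftInv hc n).1 ?_
    rw [theta_eq_thetaAt, theta_eq_thetaAt]
    exact thetaAt_absolutelyContinuous hν hc ProbabilityTheory.cond_absolutelyContinuous 0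
  rw [← heq]
  exact ProbabilityTheory.ae_cond_mem hC

end Theta

/-! ### The measures `D_k[η]` -/

section Periodic

variable {η : Measure Conf} {k : ℕ}

theorem mem_extremePoints_shiftInv_iff :
    η ∈ extremePoints ENNReal (shiftInv k) ↔ Ergodic shift^[2 ^ k] η ∧ IsProbabilityMeasure η := by
  constructor
  · exact fun h => ⟨Ergodic.of_mem_extremePoints h, h.1.2⟩
  · rintro ⟨h, h'⟩
    exact h.mem_extremePoints

theorem shiftInv_mono {j k : ℕ} (h : j ≤ k) : shiftInv j ⊆ shiftInv k := fun η hη => by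
  obtain ⟨c, hc⟩ := pow_dvd_pow 2 h
  refine ⟨?_, hη.2⟩
  rw [hc, Function.iterate_mul]
  exact hη.1.iterate c

theorem map_shift_iterate_mod (hη : η ∈ shiftInv k) (i : ℕ) :
    η.map shift^[i % 2 ^ k] = η.map shift^[i] := by
  conv_rhs => rw [← Nat.mod_add_div i (2 ^ k), Function.iterate_add, Function.iterate_mul]
  rw [← Measure.map_map (measurable_shift.iterate _) ((measurable_shift.iterate _).iterate _),
    (hη.1.iterate _).map_eq]

/-- For n ≥ k the residue modulo 2^n fixes the residue modulo 2^k, so only one summand of D_k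
contributes; invariance of `η` lets the full exponent `s.val` replace its reduction. -/
theorem D_apply (hη : η ∈ shiftInv k) {n : ℕ} (hn : k ≤ n) (s : ZMod (2 ^ n)) (E : Set Conf) :
    D k η (Prod.fst ⁻¹' E ∩ residue n ⁻¹' {s}) =
      η.map shift^[s.val] E * ((2 ^ n : ℕ) : ENNReal)⁻¹ := by
  have := hη.2
  have hF : MeasurableSet (digitClass n ⁻¹' {s}) :=
    measurable_digitClass n (measurableSet_singleton s)
  have hset : (Prod.fst ⁻¹' E ∩ residue n ⁻¹' {s} : Set (Conf × BSeq)) =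
      E ×ˢ (digitClass n ⁻¹' {s}) := rfl
  have hmem : ∀ α ∈ digitClass n ⁻¹' {s}, digitSum k α = s.val % 2 ^ k := fun α hα => by
    rw [← digitSum_mod hn, ← digitClass_val, mem_singleton_iff.1 hα]
  have hsub : digitClass n ⁻¹' {s} ⊆ cyl (s.val % 2 ^ k) k := hmem
  rw [hset, D, Measure.coe_finsetSum, Finset.sum_apply,
    Finset.sum_eq_single (s.val % 2 ^ k)]
  · rw [Measure.prod_prod, Measure.restrict_apply hF, inter_eq_left.2 hsub, lebesgue_fiber,
      map_shift_iterate_mod hη]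
  · intro i _ hi
    rw [Measure.prod_prod, Measure.restrict_apply hF,
      (disjoint_left.2 fun α hα hα' => hi ?_).inter_eq, measure_empty, mul_zero]
    rw [← hmem α hα]
    exact hα'.symm
  · exact fun h => absurd (Finset.mem_range.2 (Nat.mod_lt _ (by positivity))) h

theorem isProbabilityMeasure_D (hη : η ∈ shiftInv k) : IsProbabilityMeasure (D k η) := by
  have := hη.2
  refine ⟨?_⟩
  rw [← preimage_univ (f := residue k), ← Finset.coe_univ,
    ← sum_measure_preimage_singleton _ fun s _ => measurableSet_residue k s]
  have h : ∀ s : ZMod (2 ^ k), D k η (residue k ⁻¹' {s}) = ((2 ^ k : ℕ) : ENNReal)⁻¹ := fun s => by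
    have := Measure.isProbabilityMeasure_map (μ := η) (measurable_shift.iterate s.val).aemeasurable
    have h2 := D_apply hη le_rfl s univ
    rwa [preimage_univ, univ_inter, measure_univ, one_mul] at h2
  rw [Finset.sum_congr rfl fun s _ => h s, Finset.sum_const, Finset.card_univ, ZMod.card,
    nsmul_eq_mul]
  exact ENNReal.mul_inv_cancel (by positivity) (ENNReal.natCast_ne_top _)

theorem D_mem_prodInv (hη : η ∈ shiftInv k) : D k η ∈ prodInv := by
  have := isProbabilityMeasure_D hη
  refine ⟨⟨measurable_shiftOdometer, ?_⟩, this⟩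
  have := Measure.isProbabilityMeasure_map (μ := D k η) measurable_shiftOdometer.aemeasurable
  refine prod_measure_ext k fun n hn r E hE => ?_
  rw [Measure.map_apply measurable_shiftOdometer
    ((measurable_fst hE).inter (measurableSet_residue n r))]
  have hset : shiftOdometer ⁻¹' (Prod.fst ⁻¹' E ∩ residue n ⁻¹' {r}) =
      Prod.fst ⁻¹' (shift ⁻¹' E) ∩ residue n ⁻¹' {r - 1} := by
    ext x
    simp only [mem_inter_iff, mem_preimage, mem_singleton_iff, residue_shiftOdometer, eq_sub_iff_add_eq]
    rfl
  rw [hset, D_apply hη hn, D_apply hη hn,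
    ← Measure.map_apply measurable_shift hE,
    Measure.map_map measurable_shift (measurable_shift.iterate _), ← Function.iterate_succ',
    Nat.succ_eq_add_one, CyclicFactor.val_sub_one]
  -- For residue 0 the preceding residue is 2^n - 1, one step short of a full cycle: this is where
  -- invariance of `η` under 𝕊^(2^n) enters.
  split_ifs with h
  · rw [h, ZMod.val_zero, (shiftInv_mono hn hη).1.map_eq, Function.iterate_zero, Measure.map_id]
  · rfl

theorem theta_D (hη : η ∈ shiftInv k) {n : ℕ} (hn : k ≤ n) : theta n (D k η) = η := by
  ext E hE
  rw [theta_eq_thetaAt, thetaAt_apply (D_mem_prodInv hη) 0 hE, D_apply hη hn, ZMod.val_zero,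
    Function.iterate_zero, Measure.map_id, mul_left_comm,
    ENNReal.mul_inv_cancel (by positivity) (ENNReal.natCast_ne_top _), mul_one]

theorem D_eq_D {j : ℕ} (hη : η ∈ shiftInv j) (h : j ≤ k) : D j η = D k η := by
  have hk := shiftInv_mono h hη
  refine eq_of_theta_eq (D_mem_prodInv hη) (D_mem_prodInv hk) k fun n hn => ?_
  rw [theta_D hη (h.trans hn), theta_D hk hn]

/-- The map 𝕊^(2^k) preserves `η` and its square is ergodic, so `Ergodic.iterate_two_pow` applies to
it. This is why level k + 1 decides ergodicity of D_k. -/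
theorem ergodic_shift_of_le (hη : η ∈ shiftInv k) (h : Ergodic shift^[2 ^ (k + 1)] η) {n : ℕ}
    (hn : k + 1 ≤ n) : Ergodic shift^[2 ^ n] η := by
  obtain ⟨m, rfl⟩ := Nat.exists_eq_add_of_le hn
  have h2 : Ergodic (shift^[2 ^ k])^[2] η := by rwa [← Function.iterate_mul, ← pow_succ]
  have := h2.iterate_two_pow hη.1 m
  rwa [← Function.iterate_mul, ← pow_add, show k + (m + 1) = k + 1 + m by ring] at this

theorem D_mem_prodErg_iff (hη : η ∈ shiftInv k) :
    D k η ∈ prodErg ↔ η ∈ extremePoints ENNReal (shiftInv (k + 1)) := by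
  rw [mem_extremePoints_shiftInv_iff]
  constructor
  · intro h
    have := ergodic_thetaAt (n := k + 1) h 0
    rw [← theta_eq_thetaAt, theta_D hη k.le_succ] at this
    exact ⟨this, hη.2⟩
  · rintro ⟨h, -⟩
    refine ergodic_of_theta (D_mem_prodInv hη) (k + 1) fun n hn => ?_
    rw [theta_D hη (by omega)]
    exact ergodic_shift_of_le hη h hn

end Periodic

/-! ### Decomposition of ergodic measures -/

section Dichotomy

variable {ν : Measure (Conf × BSeq)} {n : ℕ}

/-- The law θ_n[ν] inherits invariance from level n and ergodicity from level n + 1, so it is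
ergodic at all levels m > n. There θ_m[ν] is invariant and absolutely continuous with respect to it,
hence equal to it. -/
theorem eq_D_of_theta_succ_eq (hν : ν ∈ prodErg) (h : theta (n + 1) ν = theta n ν) :
    ν = D n (theta n ν) := by
  have hi := prodErg_subset_prodInv hν
  have hθ := theta_mem_shiftInv hi n
  have he : Ergodic shift^[2 ^ (n + 1)] (theta n ν) := by
    rw [← h, theta_eq_thetaAt]; exact ergodic_thetaAt hν 0
  refine eq_of_theta_eq hi (D_mem_prodInv hθ) (n + 1) fun m hm => ?_
  rw [theta_D hθ (by omega)]
  have := hθ.2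
  have := (theta_mem_shiftInv hi m).2
  exact (ergodic_shift_of_le hθ he hm).eq_of_absolutelyContinuous (theta_mem_shiftInv hi m).1
    (theta_absolutelyContinuous_of_le hi (by omega))

/-- The gcd of `d.val` and 2^(n+1) is some 2^a with a ≤ n, and Bézout makes it a multiple of `d`. -/
theorem exists_nsmul_eq_two_pow {d : ZMod (2 ^ (n + 1))} (hd : d ≠ 0) :
    ∃ j : ℕ, j • d = ((2 ^ n : ℕ) : ZMod (2 ^ (n + 1))) := by
  obtain ⟨a, ha, hg⟩ := (Nat.dvd_prime_pow Nat.prime_two).1 (Nat.gcd_dvd_right d.val (2 ^ (n + 1)))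
  have han : a ≤ n := by
    by_contra hcon
    have h1 : a = n + 1 := by omega
    rw [h1] at hg
    have h2 : 2 ^ (n + 1) ∣ d.val := hg.symm.dvd.trans (Nat.gcd_dvd_left _ _)
    exact hd ((ZMod.val_eq_zero d).1 (Nat.eq_zero_of_dvd_of_lt h2 (ZMod.val_lt d)))
  have hb := congrArg (Int.cast : ℤ → ZMod (2 ^ (n + 1)))
    (Nat.gcd_eq_gcd_ab d.val (2 ^ (n + 1)))
  rw [hg, Int.cast_add, Int.cast_mul, Int.cast_mul, Int.cast_natCast, Int.cast_natCast,
    Int.cast_natCast, ZMod.natCast_self, zero_mul, add_zero, ZMod.natCast_zmod_val] at hb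
  refine ⟨(((2 ^ (n - a) : ℕ) : ZMod (2 ^ (n + 1))) *
    ((Nat.gcdA d.val (2 ^ (n + 1)) : ℤ) : ZMod (2 ^ (n + 1)))).val, ?_⟩
  rw [nsmul_eq_mul, ZMod.natCast_zmod_val, mul_assoc, mul_comm (Int.cast _) d, ← hb,
    ← Nat.cast_mul, ← pow_add, Nat.sub_add_cancel han]

theorem reduce_eq_zero_iff (r : ZMod (2 ^ (n + 1))) :
    reduce n r = 0 ↔ r = 0 ∨ r = ((2 ^ n : ℕ) : ZMod (2 ^ (n + 1))) := by
  constructor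
  · intro h
    rw [← ZMod.natCast_zmod_val r, map_natCast, ZMod.natCast_eq_zero_iff] at h
    obtain ⟨c, hc⟩ := h
    have hlt := ZMod.val_lt r
    have hc2 : c < 2 := by
      rw [hc] at hlt
      exact lt_of_mul_lt_mul_left (hlt.trans_eq (pow_succ 2 n)) (by positivity)
    rw [← ZMod.natCast_zmod_val r, hc]
    interval_cases c <;> simp
  · rintro (rfl | rfl)
    · exact map_zero _
    · rw [map_natCast, ZMod.natCast_self]

/-- A coincidence of two laws propagates by the shift to a period s - r of the whole cycle of laws,
hence to the period 2^n. So the laws over 0 and 2^n agree, and θ_n[ν] is their average. -/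
theorem theta_eq_of_thetaAt_eq (hν : ν ∈ prodInv) {r s : ZMod (2 ^ (n + 1))} (hrs : r ≠ s)
    (h : thetaAt (n + 1) r ν = thetaAt (n + 1) s ν) : theta (n + 1) ν = theta n ν := by
  have h1 : ∀ t, thetaAt (n + 1) t ν = thetaAt (n + 1) (t + (s - r)) ν := fun t => by
    have := congrArg (fun μ => μ.map shift^[(t - r).val]) h
    simp only [map_shift_thetaAt hν, ZMod.natCast_zmod_val] at this
    convert this using 2 <;> ring
  have h2 : ∀ j : ℕ, thetaAt (n + 1) 0 ν = thetaAt (n + 1) (j • (s - r)) ν := fun j => by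
    induction j with
    | zero => rw [zero_smul]
    | succ j ih => rw [ih, h1, succ_nsmul]
  obtain ⟨j, hj⟩ := exists_nsmul_eq_two_pow (sub_ne_zero.2 hrs.symm)
  have h3 := h2 j
  rw [hj] at h3
  ext E hE
  have h4 := congrArg (fun μ => μ E) h3
  have hne : (0 : ZMod (2 ^ (n + 1))) ≠ ((2 ^ n : ℕ) : ZMod (2 ^ (n + 1))) := fun hcon => by
    have := (ZMod.natCast_eq_zero_iff _ _).1 hcon.symm
    exact absurd (Nat.le_of_dvd (by positivity) this) (by simp [pow_succ])
  have hset : (Prod.fst ⁻¹' E ∩ residue n ⁻¹' {0} : Set (Conf × BSeq)) =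
      Prod.fst ⁻¹' E ∩ residue (n + 1) ⁻¹' {0} ∪
      Prod.fst ⁻¹' E ∩ residue (n + 1) ⁻¹' {((2 ^ n : ℕ) : ZMod (2 ^ (n + 1)))} := by
    rw [← inter_union_distrib_left]
    congr 1
    ext x
    simp only [mem_preimage, mem_singleton_iff, mem_union, ← reduce_eq_zero_iff]
    rw [residue, residue, reduce_digitClass]
  simp only [thetaAt_apply hν _ hE] at h4
  have h5 := (ENNReal.mul_right_inj (by positivity) (ENNReal.natCast_ne_top _)).1 h4
  rw [theta_eq_thetaAt, theta_eq_thetaAt, thetaAt_apply hν 0 hE, thetaAt_apply hν 0 hE, hset,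
    measure_union _ ((measurable_fst hE).inter (measurableSet_residue _ _)), ← h5, ← two_mul,
    ← mul_assoc]
  · congr 1
    push_cast
    exact pow_succ _ _
  · refine disjoint_left.2 fun x hx hx' => hne ?_
    rw [← mem_singleton_iff.1 hx.2, ← mem_singleton_iff.1 hx'.2]

/-- Choose a separating set for each ordered pair of indices. The points on the side of `μ i` in
every separation form a set of full `μ i`-measure, and these sets are disjoint for different `i`. -/
theorem exists_measurable_label {X ι : Type*} [MeasurableSpace X] [MeasurableSpace ι] [Finite ι]
    [Nonempty ι] {μ : ι → Measure X} (h : Pairwise fun i j => Measure.MutuallySingular (μ i) (μ j)) :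
    ∃ g : X → ι, Measurable g ∧ ∀ i, ∀ᵐ x ∂μ i, g x = i := by
  classical
  have : Countable ι := Finite.to_countable
  have hs : ∀ i j, ∃ s, MeasurableSet s ∧ (i ≠ j → μ i s = 0 ∧ μ j sᶜ = 0) := fun i j => by
    by_cases hij : i = j
    · exact ⟨∅, MeasurableSet.empty, fun h => absurd hij h⟩
    · obtain ⟨s, hs, h1, h2⟩ := h hij
      exact ⟨s, hs, fun _ => ⟨h1, h2⟩⟩
  choose s hs h0 using hs
  let B : ι → Set X := fun i => ⋂ j, ⋂ _ : j ≠ i, (s i j)ᶜ ∩ s j i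
  have hB : ∀ i, MeasurableSet (B i) := fun i =>
    MeasurableSet.iInter fun j => MeasurableSet.iInter fun _ => (hs i j).compl.inter (hs j i)
  obtain ⟨g, hg, hgB⟩ := exists_measurable_piecewise B hB (fun i _ => i)
    (fun _ => measurable_const) (fun i j hij x hx => by
      have h1 := (mem_iInter₂.1 hx.1 j hij.symm).1
      have h2 := (mem_iInter₂.1 hx.2 i hij).2
      exact absurd h2 h1)
  refine ⟨g, hg, fun i => ?_⟩
  have : ∀ᵐ x ∂μ i, ∀ j, j ≠ i → x ∈ (s i j)ᶜ ∩ s j i := by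
    refine ae_all_iff.2 fun j => ?_
    by_cases hij : j = i
    · exact Filter.Eventually.of_forall fun x h => absurd hij h
    · have h1 : ∀ᵐ x ∂μ i, x ∉ s i j := measure_eq_zero_iff_ae_notMem.1 (h0 i j (Ne.symm hij)).1
      have h2 : ∀ᵐ x ∂μ i, x ∉ (s j i)ᶜ := measure_eq_zero_iff_ae_notMem.1 (h0 j i hij).2
      filter_upwards [h1, h2] with x h1 h2 _
      exact ⟨h1, not_not.1 h2⟩
  filter_upwards [this] with x hx
  exact hgB i (mem_iInter₂.2 hx)

/-- If `θ_{n+1}[ν] ≠ θ_n[ν]`, the first `n + 1` digits of the second coordinate are a function of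
the first coordinate. -/
theorem exists_label_of_theta_ne (hν : ν ∈ prodErg) (h : theta (n + 1) ν ≠ theta n ν) :
    ∃ g : Conf → ZMod (2 ^ (n + 1)), Measurable g ∧ ∀ᵐ x ∂ν, g x.1 = residue (n + 1) x := by
  have hi := prodErg_subset_prodInv hν
  have := hν.2
  obtain ⟨g, hg, hgr⟩ := exists_measurable_label (μ := fun r => thetaAt (n + 1) r ν)
    fun r s hrs => by
      have := isProbabilityMeasure_thetaAt hi r
      have := isProbabilityMeasure_thetaAt hi s
      exact (ergodic_thetaAt hν r).mutuallySingular_of_ne (ergodic_thetaAt hν s)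
        fun heq => h (theta_eq_of_thetaAt_eq hi hrs heq)
  refine ⟨g, hg, ?_⟩
  have h1 : ∀ r : ZMod (2 ^ (n + 1)), ∀ᵐ x ∂ν, residue (n + 1) x = r → g x.1 = r := fun r => by
    have h2 := ae_of_ae_map measurable_fst.aemeasurable (hgr r)
    rw [ProbabilityTheory.cond, Measure.ae_ennreal_smul_measure_eq
      (ENNReal.inv_ne_zero.2 (measure_ne_top ν _))] at h2
    exact (ae_restrict_iff' (measurableSet_residue _ r)).1 h2
  filter_upwards [ae_all_iff.2 h1] with x hx
  exact hx _ rfl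

/-- Equivariance passes from `ν` to its projection. Measurability of the diagonal of `Y` makes the
set where it holds measurable, as `ae_map_iff` requires. -/
theorem ae_proj_of_label {Y : Type*} [MeasurableSpace Y] [MeasurableEq Y]
    {g : Conf → Y} (hg : Measurable g) {r : Conf × BSeq → Y} {R : Y → Y} (hR : Measurable R)
    (hν : ν ∈ prodInv) (hr : ∀ x, r (shiftOdometer x) = R (r x)) (h : ∀ᵐ x ∂ν, g x.1 = r x) :
    ∀ᵐ w ∂proj ν, g (shift w) = R (g w) := by
  have hd : MeasurableSet {w | g (shift w) = R (g w)} :=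
    measurableSet_eq_fun (hg.comp measurable_shift) (hR.comp hg)
  rw [proj, ae_map_iff measurable_fst.aemeasurable hd]
  filter_upwards [h, hν.1.quasiMeasurePreserving.ae h] with x h1 h2
  rw [h1, ← hr]
  exact h2

end Dichotomy

/-! ### Ergodic measures of periodic type -/

section PeriodicType

variable {η : Measure Conf} {ν : Measure (Conf × BSeq)} {k : ℕ}

theorem exists_isPeriodicType_iff : (∃ k, IsPeriodicType k ν) ↔ ∃ j, ∃ η ∈ shiftInv j, ν = D j η := by
  constructor
  · rintro ⟨k, hk, -⟩
    exact ⟨k, hk⟩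
  · intro h
    exact ⟨_, Nat.sInf_mem (s := {j | ∃ η ∈ shiftInv j, ν = D j η}) h, fun j hj => Nat.sInf_le hj⟩

/-- For j ≤ k the projection θ_k recovers `η'` from D_j[η'], so any representation at a lower level
must use `η` itself. -/
theorem isPeriodicType_D_iff (hη : η ∈ shiftInv k) :
    IsPeriodicType k (D k η) ↔ ∀ j < k, η ∉ shiftInv j := by
  constructor
  · intro h j hj hηj
    exact absurd (h.2 ⟨η, hηj, (D_eq_D hηj hj.le).symm⟩) (not_le.2 hj)
  · refine fun h => ⟨⟨η, hη, rfl⟩, ?_⟩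
    rintro j ⟨η', hη', heq⟩
    by_contra hcon
    have hj : j < k := not_le.1 hcon
    have := congrArg (theta k) heq
    rw [theta_D hη le_rfl, theta_D hη' hj.le] at this
    exact h j hj (this ▸ hη')

theorem ergodic_periodicType_eq (k : ℕ) : {ν | ν ∈ prodErg ∧ IsPeriodicType k ν} =
    D k '' {η | η ∈ shiftInv k ∩ extremePoints ENNReal (shiftInv (k + 1)) ∧
      ∀ j < k, η ∉ shiftInv j} := by
  ext ν
  constructor
  · rintro ⟨he, hp⟩
    obtain ⟨η, hη, rfl⟩ := hp.1
    exact ⟨η, ⟨⟨hη, (D_mem_prodErg_iff hη).1 he⟩, (isPeriodicType_D_iff hη).1 hp⟩, rfl⟩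
  · rintro ⟨η, ⟨⟨hη, he⟩, hp⟩, rfl⟩
    exact ⟨(D_mem_prodErg_iff hη).2 he, (isPeriodicType_D_iff hη).2 hp⟩

theorem theta_absolutelyContinuous_proj (n : ℕ) : theta n ν ≪ proj ν :=
  ProbabilityTheory.cond_absolutelyContinuous.map measurable_fst

theorem hasRotationFactor_iff (hη : η ∈ shiftErg) (n : ℕ) : HasRotationFactor η n ↔
    ∃ q : Conf → ZMod (2 ^ n), Measurable q ∧ ∀ᵐ w ∂η, q (shift w) = q w + 1 := by
  have := hη.2
  constructor
  · rintro ⟨q, hq, h⟩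
    exact ⟨q, hq.measurable, h⟩
  · rintro ⟨q, hq, h⟩
    exact ⟨q, CyclicFactor.measurePreserving hη.1.toMeasurePreserving hq h, h⟩

theorem two_pow_ne_zero_of_lt {j k : ℕ} (h : j < k) : ((2 ^ j : ℕ) : ZMod (2 ^ k)) ≠ 0 := fun h0 =>
  absurd (Nat.le_of_dvd (by positivity) ((ZMod.natCast_eq_zero_iff _ _).1 h0))
    (not_le.2 (Nat.pow_lt_pow_right one_lt_two h))

theorem theta_succ_ne_of_forall_ne (hν : ν ∈ prodErg) {n : ℕ}
    (h : ∀ η ∈ shiftInv n, ν ≠ D n η) : theta (n + 1) ν ≠ theta n ν := fun heq =>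
  h _ (theta_mem_shiftInv (prodErg_subset_prodInv hν) n) (eq_D_of_theta_succ_eq hν heq)

/-- For k = n + 1, minimality of the type excludes a representation by D_n, so the residue modulo
2^(n+1) is a function of the first coordinate; this function is the factor map. -/
theorem hasRotationFactor_of_isPeriodicType (hν : ν ∈ prodErg) (hp : IsPeriodicType k ν) :
    HasRotationFactor (proj ν) k := by
  rw [hasRotationFactor_iff (proj_mem_shiftErg hν)]
  cases k with
  | zero => exact ⟨fun _ => 0, measurable_const, Filter.Eventually.of_forall fun _ =>
      Subsingleton.elim (α := ZMod 1) _ _⟩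
  | succ n =>
    obtain ⟨g, hg, hgr⟩ := exists_label_of_theta_ne hν (theta_succ_ne_of_forall_ne hν
      fun η hη heq => absurd (hp.2 ⟨η, hη, heq⟩) (not_le.2 n.lt_succ_self))
    exact ⟨g, hg, ae_proj_of_label hg (Measurable.of_discrete (f := fun r => r + 1))
      (prodErg_subset_prodInv hν) (residue_shiftOdometer _) hgr⟩

/-- A factor map to ℤ/2^(k+1) is invariant under 𝕊^(2^(k+1)), hence constant `η`-almost everywhere.
But 𝕊^(2^k) preserves `η` and changes the value by 2^k ≠ 0. -/
theorem not_hasRotationFactor_D (hη : η ∈ shiftInv k) (he : D k η ∈ prodErg) :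
    ¬ HasRotationFactor (proj (D k η)) (k + 1) := by
  have hE := proj_mem_shiftErg he
  rw [hasRotationFactor_iff hE]
  rintro ⟨q, hq, h⟩
  have hac := theta_absolutelyContinuous_proj (ν := D k η) k
  rw [theta_D hη le_rfl] at hac
  have h1 : ∀ᵐ w ∂η, ∀ j : ℕ, q (shift^[j] w) = q w + j :=
    hac.ae_le (CyclicFactor.ae_iterate hE.1.toMeasurePreserving h)
  have hErg := (mem_extremePoints_shiftInv_iff.1 ((D_mem_prodErg_iff hη).1 he)).1
  have := hη.2
  obtain ⟨c, hc⟩ := hErg.ae_eq_const_of_ae_eq_comp₀ hq.nullMeasurable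
    (h1.mono fun w hw => by
      change q (shift^[2 ^ (k + 1)] w) = q w
      rw [hw, ZMod.natCast_self, add_zero])
  obtain ⟨w, hw1, hw2, hw3⟩ := (h1.and (hc.and (hη.1.quasiMeasurePreserving.ae hc))).exists
  have h2 := hw1 (2 ^ k)
  rw [hw2, hw3] at h2
  exact two_pow_ne_zero_of_lt k.lt_succ_self (left_eq_add.1 h2)

/-- The witness is D_k of `η` conditioned on the fibre over 0; were its return map not ergodic after
squaring, the factor could be refined. -/
theorem exists_of_hasRotationFactor (hη : η ∈ shiftErg) (h : HasRotationFactor η k)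
    (h' : ¬ HasRotationFactor η (k + 1)) : ∃ ν ∈ prodErg, IsPeriodicType k ν ∧ proj ν = η := by
  rw [hasRotationFactor_iff hη] at h h'
  obtain ⟨q, hq, h⟩ := h
  have hp := hη.2
  have hm := hη.1.toMeasurePreserving
  have hne := CyclicFactor.measure_fiber_ne_zero hm hq h
  have hprob := ProbabilityTheory.cond_isProbabilityMeasure (hne 0)
  have hθ : ProbabilityTheory.cond η (q ⁻¹' {0}) ∈ shiftInv k :=
    ⟨CyclicFactor.measurePreserving_cond hm hq h 0, hprob⟩
  have hex := mem_extremePoints_shiftInv_iff.2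
    ⟨(CyclicFactor.ergodic_cond_or_exists hη.1 hq h).resolve_right h', hprob⟩
  have hE := (D_mem_prodErg_iff hθ).2 hex
  refine ⟨D k _, hE, (isPeriodicType_D_iff hθ).2 fun j hj hθj => ?_, ?_⟩
  -- For j < k the map 𝕊^(2^j) carries the fibre measure to the one over 2^j ≠ 0, which lives on a
  -- disjoint set.
  · have h1 := hθj.1.map_eq
    rw [CyclicFactor.map_cond_fiber_iterate hm hq h, zero_add] at h1
    have h2 := ProbabilityTheory.ae_cond_mem (μ := η) (hq (measurableSet_singleton 0))
    have h3 := ProbabilityTheory.ae_cond_mem (μ := η)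
      (hq (measurableSet_singleton ((2 ^ j : ℕ) : ZMod (2 ^ k))))
    rw [h1] at h3
    obtain ⟨w, hw, hw'⟩ := (h2.and h3).exists
    exact two_pow_ne_zero_of_lt hj (hw'.symm.trans hw)
  -- Both `η` and the projection of D_k are ergodic and dominate the same fibre measure, so they
  -- cannot be mutually singular.
  · by_contra hcon
    have hpe := proj_mem_shiftErg hE
    have := hpe.2
    have hs := hpe.1.mutuallySingular_of_ne hη.1 hcon
    have hac := theta_absolutelyContinuous_proj (ν := D k (ProbabilityTheory.cond η (q ⁻¹' {0}))) k
    rw [theta_D hθ le_rfl] at hac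
    have := hs.mono_ac hac (ProbabilityTheory.cond_absolutelyContinuous (s := q ⁻¹' {0}))
    exact IsProbabilityMeasure.ne_zero _ (Measure.MutuallySingular.self_iff _ |>.1 this)

theorem proj_ergodic_periodicType_eq (k : ℕ) :
    proj '' {ν | ν ∈ prodErg ∧ IsPeriodicType k ν} =
      {η | η ∈ shiftErg ∧ HasRotationFactor η k ∧ ¬ HasRotationFactor η (k + 1)} := by
  ext η
  constructor
  · rintro ⟨ν, ⟨he, hp⟩, rfl⟩
    refine ⟨proj_mem_shiftErg he, hasRotationFactor_of_isPeriodicType he hp, ?_⟩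
    obtain ⟨η, hη, rfl⟩ := hp.1
    exact not_hasRotationFactor_D hη he
  · rintro ⟨hη, h, h'⟩
    obtain ⟨ν, he, hp, rfl⟩ := exists_of_hasRotationFactor hη h h'
    exact ⟨ν, ⟨he, hp⟩, rfl⟩

end PeriodicType

/-! ### Eigenfunctions and residues -/

/-- The power of `ϱ_n` whose exponent is a residue modulo `2 ^ n`. -/
noncomputable def rhoPow (n : ℕ) (s : ZMod (2 ^ n)) : ℂ := rho n ^ s.val

theorem rho_isPrimitiveRoot (n : ℕ) : IsPrimitiveRoot (rho n) (2 ^ n) := by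
  have := Complex.isPrimitiveRoot_exp (2 ^ n) (by positivity)
  rwa [Nat.cast_pow, Nat.cast_ofNat] at this

theorem rho_pow_eq (n a : ℕ) : rho n ^ a = rhoPow n (a : ZMod (2 ^ n)) := by
  rw [rhoPow, ZMod.val_natCast, ← pow_mod_orderOf, ← (rho_isPrimitiveRoot n).eq_orderOf]

theorem rhoPow_injective (n : ℕ) : Function.Injective (rhoPow n) := fun s t h =>
  ZMod.val_injective _ ((rho_isPrimitiveRoot n).pow_inj (ZMod.val_lt s) (ZMod.val_lt t) h)

theorem rhoPow_add_one (n : ℕ) (s : ZMod (2 ^ n)) : rhoPow n (s + 1) = rho n * rhoPow n s := by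
  rw [rhoPow, rhoPow, ← pow_succ', rho_pow_eq n (s.val + 1), rhoPow]
  congr 1
  push_cast
  rw [ZMod.natCast_zmod_val]

theorem rho_succ_sq (n : ℕ) : rho (n + 1) ^ 2 = rho n := by
  rw [rho, rho, ← Complex.exp_nat_mul]
  congr 1
  rw [pow_succ]
  field_simp
  push_cast
  ring

theorem rhoPow_succ_sq (n : ℕ) (s : ZMod (2 ^ (n + 1))) :
    rhoPow (n + 1) s ^ 2 = rhoPow n (reduce n s) := by
  conv_rhs => rw [← ZMod.natCast_zmod_val s, map_natCast, ← rho_pow_eq, ← rho_succ_sq]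
  rw [rhoPow, ← pow_mul, ← pow_mul, mul_comm]

theorem exists_rhoPow_eq {n : ℕ} {z : ℂ} (h : z ^ 2 ^ n = 1) : ∃ s, z = rhoPow n s := by
  obtain ⟨i, -, hi⟩ := (rho_isPrimitiveRoot n).eq_pow_of_pow_eq_one h
  exact ⟨i, by rw [← rho_pow_eq, hi]⟩

/-- A coherent system of equivariant maps of the shift on `(I^ℤ, η)` to the cyclic groups of
orders `2 ^ n`. -/
structure IsResidueSystem (η : Measure Conf) (q : ∀ n, Conf → ZMod (2 ^ n)) : Prop where
  measurable : ∀ n, Measurable (q n)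
  shift : ∀ n, ∀ᵐ w ∂η, q n (shift w) = q n w + 1
  reduce : ∀ n, ∀ᵐ w ∂η, reduce n (q (n + 1) w) = q n w

/-- From f_0 = 1 and f_n = f_{n+1}² one gets f_n^(2^n) = 1 almost everywhere, so f_n is a power of
ϱ_n; its exponent is the residue. -/
theorem IsEigenSystem.exists_residueSystem {η : Measure Conf}
    {f : ℕ → Conf → ℂ} (hf : IsEigenSystem η f) :
    ∃ q, IsResidueSystem η q ∧ ∀ n, ∀ᵐ w ∂η, f n w = rhoPow n (q n w) := by
  have hroot : ∀ n, ∀ᵐ w ∂η, f n w ^ 2 ^ n = 1 := fun n => by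
    induction n with
    | zero => simpa using hf.zero
    | succ n ih =>
      filter_upwards [ih, hf.sq n] with w h1 h2
      rw [pow_succ', pow_mul, ← h2, h1]
  have hq : ∀ n, ∃ q : Conf → ZMod (2 ^ n), Measurable q ∧ ∀ s, ∀ w, f n w = rhoPow n s → q w = s := by
    intro n
    obtain ⟨q, hq, hqs⟩ := exists_measurable_piecewise (fun s => f n ⁻¹' {rhoPow n s})
      (fun s => hf.measurable n (measurableSet_singleton _)) (fun s _ => s)
      (fun _ => measurable_const)
      (fun s t hst w hw => absurd (rhoPow_injective n (hw.1.symm.trans hw.2)) hst)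
    exact ⟨q, hq, fun s w hw => hqs s hw⟩
  choose q hq hqs using hq
  have hfq : ∀ n, ∀ᵐ w ∂η, f n w = rhoPow n (q n w) := fun n => by
    filter_upwards [hroot n] with w hw
    obtain ⟨s, hs⟩ := exists_rhoPow_eq hw
    rw [hqs n s w hs, hs]
  refine ⟨q, ⟨hq, fun n => ?_, fun n => ?_⟩, hfq⟩
  · filter_upwards [hfq n, hf.eigen n] with w h1 h2
    exact hqs n _ _ (by rw [h2, h1, rhoPow_add_one])
  · filter_upwards [hfq (n + 1), hf.sq n] with w h1 h2
    exact (hqs n _ _ (by rw [h2, h1, rhoPow_succ_sq])).symm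

theorem exists_eigenSystem {η : Measure Conf} (h : HasOdometerFactor η) :
    ∃ f, IsEigenSystem η f := by
  obtain ⟨p, hp, h⟩ := h
  refine ⟨fun n w => rhoPow n (digitClass n (p w)), ⟨fun n => ?_, ?_, fun n => ?_, fun n => ?_⟩⟩
  · exact (Measurable.of_discrete (f := rhoPow n)).comp
      ((measurable_digitClass n).comp hp.measurable)
  · exact Filter.Eventually.of_forall fun w => by simp [rhoPow, digitClass, digitSum]
  · exact Filter.Eventually.of_forall fun w => by rw [rhoPow_succ_sq, reduce_digitClass]
  · filter_upwards [h] with w hw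
    rw [hw, digitClass_odometer, rhoPow_add_one]

theorem thetaAlpha_eq {η : Measure Conf} {f : ℕ → Conf → ℂ} {q : ∀ n, Conf → ZMod (2 ^ n)} (n : ℕ)
    (h : ∀ᵐ w ∂η, f n w = rhoPow n (q n w)) (α : BSeq) :
    thetaAlpha η f α n = ProbabilityTheory.cond η (q n ⁻¹' {digitClass n α}) := by
  have hset : levelSet f (digitSum n α) n =ᵐ[η] q n ⁻¹' {digitClass n α} := by
    filter_upwards [h] with w hw
    apply propext
    change f n w = rho n ^ digitSum n α ↔ q n w = digitClass n α
    rw [hw, rho_pow_eq, (rhoPow_injective n).eq_iff]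
    rfl
  rw [thetaAlpha, ProbabilityTheory.cond, ProbabilityTheory.cond, measure_congr hset,
    Measure.restrict_congr_set hset]

/-! ### Ergodic aperiodic measures -/

section Aperiodic

variable {η : Measure Conf} {q : ∀ n, Conf → ZMod (2 ^ n)} {ν : Measure (Conf × BSeq)} {α : BSeq}

/-- `ν` belongs to `𝕄`, and its projections `θ_n` are the normalized restrictions of `η` to the
sets where `q n` has the residue of `α`. -/
def IsNuResidue (η : Measure Conf) (q : ∀ n, Conf → ZMod (2 ^ n)) (α : BSeq)
    (ν : Measure (Conf × BSeq)) : Prop :=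
  ν ∈ prodInv ∧ ∀ n, theta n ν = ProbabilityTheory.cond η (q n ⁻¹' {digitClass n α})

theorem IsNuResidue.unique {ν' : Measure (Conf × BSeq)} (h : IsNuResidue η q α ν)
    (h' : IsNuResidue η q α ν') : ν = ν' :=
  eq_of_theta_eq h.1 h'.1 0 fun n _ => by rw [h.2, h'.2]

theorem theta_map_graph {p : Conf → BSeq} (hp : Measurable p)
    (hν : η.map (fun w => (w, p w)) ∈ prodInv) (n : ℕ) :
    theta n (η.map fun w => (w, p w)) = ProbabilityTheory.cond η {w | digitClass n (p w) = 0} := by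
  have hg : Measurable fun w : Conf => (w, p w) := measurable_id.prodMk hp
  have hset : MeasurableSet {w | digitClass n (p w) = 0} :=
    (measurable_digitClass n).comp hp (measurableSet_singleton 0)
  ext E hE
  rw [theta_eq_thetaAt, thetaAt_apply hν 0 hE, ProbabilityTheory.cond_apply hset,
    Measure.map_apply hg ((measurable_fst hE).inter (measurableSet_residue n 0))]
  have h1 := measure_residue (n := n) hν 0
  rw [Measure.map_apply hg (measurableSet_residue n 0)] at h1
  have h2 : η {w | digitClass n (p w) = 0} = ((2 ^ n : ℕ) : ENNReal)⁻¹ := h1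
  rw [h2, inv_inv, inter_comm]
  rfl

/-- The measure is the image of `η` on the graph of the equivariant map whose residues are `q n`
minus those of `α`: the second coordinate begins with `n` zeros exactly where `q n` equals the
residue of `α`. -/
theorem IsResidueSystem.exists_isNuResidue (hq : IsResidueSystem η q) (hη : η ∈ shiftInv 0)
    (α : BSeq) : ∃ ν, IsNuResidue η q α ν ∧ proj ν = η := by
  have hm : MeasurePreserving _root_.shift η η := hη.1
  have := hη.2
  let p : Conf → BSeq := fun w => ofResidues fun n => q n w - digitClass n α
  have hp : Measurable p := measurable_ofResidues fun n =>
    (Measurable.of_discrete (f := fun s => s - digitClass n α)).comp (hq.measurable n)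
  have hpq : ∀ᵐ w ∂η, ∀ n, digitClass n (p w) = q n w - digitClass n α := by
    filter_upwards [ae_all_iff.2 hq.reduce] with w hw n
    exact digitClass_ofResidues (c := fun n => q n w - digitClass n α) (fun n => by
      rw [map_sub, hw, reduce_digitClass]) n
  have hg : Measurable fun w : Conf => (w, p w) := measurable_id.prodMk hp
  have hν : η.map (fun w => (w, p w)) ∈ prodInv := by
    refine ⟨⟨measurable_shiftOdometer, ?_⟩, Measure.isProbabilityMeasure_map hg.aemeasurable⟩
    rw [Measure.map_map measurable_shiftOdometer hg]
    conv_rhs => rw [← hm.map_eq, Measure.map_map hg hm.measurable]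
    refine Measure.map_congr ?_
    filter_upwards [hpq, hm.quasiMeasurePreserving.ae hpq, ae_all_iff.2 hq.shift] with w h1 h2 h3
    refine Prod.ext rfl (ext_digitClass fun n => ?_)
    change digitClass n (odometer (p w)) = digitClass n (p (_root_.shift w))
    rw [digitClass_odometer, h1, h2, h3]
    ring
  refine ⟨_, ⟨hν, fun n => ?_⟩, ?_⟩
  · rw [theta_map_graph hp hν]
    have hset : {w | digitClass n (p w) = 0} =ᵐ[η] q n ⁻¹' {digitClass n α} := by
      filter_upwards [hpq] with w hw
      apply propext
      change digitClass n (p w) = 0 ↔ q n w = digitClass n α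
      rw [hw, sub_eq_zero]
    rw [ProbabilityTheory.cond, ProbabilityTheory.cond, measure_congr hset,
      Measure.restrict_congr_set hset]
  · rw [proj, Measure.map_map measurable_fst hg]
    exact Measure.map_id

theorem shiftErg_subset : shiftErg ⊆ shiftInv 0 := fun _ h => ⟨h.1.toMeasurePreserving, h.2⟩

theorem IsNuResidue.mem_prodErg (h : IsNuResidue η q α ν) (hη : η ∈ shiftErg)
    (hq : IsResidueSystem η q) : ν ∈ prodErg := by
  have := hη.2
  refine ergodic_of_theta h.1 0 fun n _ => ?_
  rw [h.2]
  exact CyclicFactor.ergodic_cond hη.1 (hq.measurable n) (hq.shift n) _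

theorem isAperiodic_iff : IsAperiodic ν ↔ ν ∈ prodInv ∧ ∀ j, ∀ η ∈ shiftInv j, ν ≠ D j η := by
  rw [IsAperiodic, exists_isPeriodicType_iff]
  simp only [not_exists, not_and, ne_eq]

/-- If `ν` were D_k, then θ_k and θ_{k+1} would coincide, although they are restrictions of `η` to
sets of measure 2^(-k) and 2^(-k-1). -/
theorem IsNuResidue.isAperiodic (h : IsNuResidue η q α ν) (hη : η ∈ shiftErg)
    (hq : IsResidueSystem η q) : IsAperiodic ν := by
  have := hη.2
  have hm := hη.1.toMeasurePreserving
  refine isAperiodic_iff.2 ⟨h.1, ?_⟩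
  rintro k η' hη' rfl
  have h1 := h.2 k
  have h2 := h.2 (k + 1)
  rw [theta_D hη' le_rfl] at h1
  rw [theta_D hη' k.le_succ, h1] at h2
  have h3 := congrArg (fun μ => μ (q (k + 1) ⁻¹' {digitClass (k + 1) α})) h2
  have hB := hq.measurable (k + 1) (measurableSet_singleton (digitClass (k + 1) α))
  rw [ProbabilityTheory.cond_apply_self (CyclicFactor.measure_fiber_ne_zero hm (hq.measurable _)
    (hq.shift _) _) (measure_ne_top _ _),
    ProbabilityTheory.cond_apply (hq.measurable k (measurableSet_singleton _)),
    CyclicFactor.measure_fiber hm (hq.measurable k) (hq.shift k), inv_inv] at h3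
  have h4 : η (q k ⁻¹' {digitClass k α} ∩ q (k + 1) ⁻¹' {digitClass (k + 1) α}) ≤
      ((2 ^ (k + 1) : ℕ) : ENNReal)⁻¹ := by
    rw [← CyclicFactor.measure_fiber hm (hq.measurable (k + 1)) (hq.shift (k + 1))
      (digitClass (k + 1) α)]
    exact measure_mono inter_subset_right
  have h5 : (1 : ENNReal) ≤ ((2 ^ k : ℕ) : ENNReal) * ((2 ^ (k + 1) : ℕ) : ENNReal)⁻¹ := by
    rw [← h3]; gcongr
  rw [← div_eq_mul_inv, ENNReal.le_div_iff_mul_le (by simp) (by simp), one_mul] at h5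
  have h6 : 2 ^ (k + 1) ≤ 2 ^ k := by exact_mod_cast h5
  exact absurd h6 (not_le.2 (Nat.pow_lt_pow_right one_lt_two k.lt_succ_self))

/-- For an ergodic aperiodic measure the second coordinate is a function of the first one. -/
theorem exists_graph (hν : ν ∈ prodErg) (ha : IsAperiodic ν) :
    ∃ p : Conf → BSeq, Measurable p ∧ ∀ᵐ x ∂ν, p x.1 = x.2 := by
  have h : ∀ n, ∃ g : Conf → ZMod (2 ^ n), Measurable g ∧ ∀ᵐ x ∂ν, g x.1 = residue n x := fun n => by
    rcases n with - | n
    · exact ⟨fun _ => 0, measurable_const, Filter.Eventually.of_forall fun _ =>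
        Subsingleton.elim (α := ZMod 1) _ _⟩
    · have h1 := (isAperiodic_iff.1 ha).2 n
      exact exists_label_of_theta_ne hν (theta_succ_ne_of_forall_ne hν h1)
  choose g hg hgr using h
  refine ⟨fun w => ofResidues fun n => g n w, measurable_ofResidues hg, ?_⟩
  filter_upwards [ae_all_iff.2 hgr] with x hx
  refine ext_digitClass fun n => ?_
  simp only [hx]
  exact digitClass_ofResidues (c := fun n => residue n x) (fun n => reduce_digitClass n x.2) n

theorem exists_isNuResidue_of_isAperiodic (hν : ν ∈ prodErg) (ha : IsAperiodic ν) :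
    HasOdometerFactor (proj ν) ∧
      ∀ q, IsResidueSystem (proj ν) q → ∃ α, IsNuResidue (proj ν) q α ν := by
  have hi := prodErg_subset_prodInv hν
  have hη := proj_mem_shiftErg hν
  have := hη.2
  obtain ⟨p, hp, hpν⟩ := exists_graph hν ha
  have hpS := ae_proj_of_label hp measurable_odometer hi (r := Prod.snd) (fun _ => rfl) hpν
  refine ⟨⟨p, measurePreserving_of_odometer hη.1.toMeasurePreserving hp hpS, hpS⟩, fun q hq => ?_⟩
  have hg : Measurable fun w : Conf => (w, p w) := measurable_id.prodMk hp
  have hgraph : ν = (proj ν).map fun w => (w, p w) := by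
    rw [proj, Measure.map_map hg measurable_fst]
    conv_lhs => rw [← Measure.map_id (μ := ν)]
    refine Measure.map_congr ?_
    filter_upwards [hpν] with x hx
    exact Prod.ext rfl hx.symm
  -- Two equivariant maps to the same cyclic group differ by an invariant function, constant by
  -- ergodicity; coherence in `n` assembles the constants into `α`.
  have hc : ∀ n, ∃ c, ∀ᵐ w ∂proj ν, q n w - digitClass n (p w) = c := fun n =>
    hη.1.ae_eq_const_of_ae_eq_comp₀
      ((hq.measurable n).sub ((measurable_digitClass n).comp hp)).nullMeasurable (by
        filter_upwards [hq.shift n, hpS] with w h1 h2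
        change q n (_root_.shift w) - digitClass n (p (_root_.shift w)) = q n w - digitClass n (p w)
        rw [h1, h2, digitClass_odometer]
        ring)
  choose c hc using hc
  obtain ⟨w, hw1, hw2⟩ := ((ae_all_iff.2 hc).and (ae_all_iff.2 hq.reduce)).exists
  have hα := digitClass_ofResidues (c := c) fun n => by
    rw [← hw1 (n + 1), map_sub, hw2, reduce_digitClass, hw1]
  refine ⟨ofResidues c, hi, fun n => ?_⟩
  have hth := theta_map_graph hp (hgraph ▸ hi) n
  rw [← hgraph] at hth
  rw [hth, hα]
  have hset : {w | digitClass n (p w) = 0} =ᵐ[proj ν] q n ⁻¹' {c n} := by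
    filter_upwards [hc n] with w hw
    apply propext
    change digitClass n (p w) = 0 ↔ q n w = c n
    rw [← hw, eq_comm (a := q n w), sub_eq_self]
  rw [ProbabilityTheory.cond, ProbabilityTheory.cond, measure_congr hset,
    Measure.restrict_congr_set hset]

theorem isNuAlpha_iff {f : ℕ → Conf → ℂ} (h : ∀ n, ∀ᵐ w ∂η, f n w = rhoPow n (q n w)) :
    IsNuAlpha η f α ν ↔ IsNuResidue η q α ν := by
  simp only [IsNuAlpha, IsNuResidue, thetaAlpha_eq _ (h _)]

theorem existsUnique_isNuAlpha {f : ℕ → Conf → ℂ} (hη : η ∈ shiftErg) (hf : IsEigenSystem η f)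
    (α : BSeq) : ∃! ν, IsNuAlpha η f α ν := by
  obtain ⟨q, hq, hfq⟩ := hf.exists_residueSystem
  simp only [isNuAlpha_iff hfq]
  obtain ⟨ν, hν, -⟩ := hq.exists_isNuResidue (shiftErg_subset hη) α
  exact ⟨ν, hν, fun ν' hν' => hν'.unique hν⟩

theorem ergodic_aperiodic_proj_eq {f : ℕ → Conf → ℂ} (hη : η ∈ shiftErg)
    (hf : IsEigenSystem η f) :
    {ν | ν ∈ prodErg ∧ IsAperiodic ν ∧ proj ν = η} = {ν | ∃ α, IsNuAlpha η f α ν} := by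
  obtain ⟨q, hq, hfq⟩ := hf.exists_residueSystem
  simp only [isNuAlpha_iff hfq]
  ext ν
  constructor
  · rintro ⟨he, ha, rfl⟩
    exact (exists_isNuResidue_of_isAperiodic he ha).2 q hq
  · rintro ⟨α, hα⟩
    obtain ⟨ν', hν', hp⟩ := hq.exists_isNuResidue (shiftErg_subset hη) α
    refine ⟨hα.mem_prodErg hη hq, hα.isAperiodic hη hq, ?_⟩
    rw [hα.unique hν', hp]

theorem ergodic_aperiodic_eq : {ν | ν ∈ prodErg ∧ IsAperiodic ν} =
    {ν | ∃ η ∈ shiftErg, HasOdometerFactor η ∧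
      ∃ f, IsEigenSystem η f ∧ ∃ α, IsNuAlpha η f α ν} := by
  ext ν
  constructor
  · rintro ⟨he, ha⟩
    have hη := proj_mem_shiftErg he
    have ho := (exists_isNuResidue_of_isAperiodic he ha).1
    obtain ⟨f, hf⟩ := exists_eigenSystem ho
    have : ν ∈ {ν' | ν' ∈ prodErg ∧ IsAperiodic ν' ∧ proj ν' = proj ν} := ⟨he, ha, rfl⟩
    rw [ergodic_aperiodic_proj_eq hη hf] at this
    exact ⟨_, hη, ho, f, hf, this⟩
  · rintro ⟨η, hη, -, f, hf, h⟩
    have : ν ∈ {ν | ν ∈ prodErg ∧ IsAperiodic ν ∧ proj ν = η} := by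
      rw [ergodic_aperiodic_proj_eq hη hf]; exact h
    exact ⟨this.1, this.2.1⟩

end Aperiodic

/-! ### Words and vertices of the graph of ordered pairs -/

/-- The letters of the word of length `2 ^ n` that corresponds to a vertex on floor `n`. -/
def OP.letter : ∀ n, OP n → ℕ → Bool
  | 0, v, _ => v
  | n + 1, v, i =>
    if i < 2 ^ n then OP.letter n (OP.child false v) i else OP.letter n (OP.child true v) (i - 2 ^ n)

theorem OP.ext_letter {n : ℕ} {u v : OP n} (h : ∀ i < 2 ^ n, OP.letter n u i = OP.letter n v i) :
    u = v := by
  induction n with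
  | zero => exact h 0 (by simp)
  | succ n ih =>
    refine Prod.ext (ih fun i hi => ?_) (ih fun i hi => ?_)
    · have := h i (by rw [pow_succ]; omega)
      simp only [OP.letter, if_pos hi] at this
      exact this
    · have := h (i + 2 ^ n) (by rw [pow_succ]; omega)
      simp only [OP.letter, if_neg (show ¬ i + 2 ^ n < 2 ^ n by omega),
        Nat.add_sub_cancel] at this
      exact this

theorem OPPath.ext {x y : OPPath} (hv : x.vert = y.vert) (he : x.edge = y.edge) : x = y := by
  cases x; cases y; cases hv; cases he; rfl

/-- Edge index 1 at floor `n` selects the right half of the next word, an offset of 2^n; the indices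
are thus the binary digits of the position. -/
theorem OPPath.vert_zero (x : OPPath) (n : ℕ) :
    x.vert 0 = OP.letter n (x.vert n) (digitSum n x.edge) := by
  induction n with
  | zero => rfl
  | succ n ih =>
    have hlt := digitSum_lt n x.edge
    rw [ih, digitSum_succ, x.compat n]
    cases x.edge n
    · simp [OP.letter, hlt]
      rfl
    · simp [OP.letter]
      rfl

/-- The shift of a two-sided sequence by `j`. -/
def shiftBy (j : ℤ) (w : Conf) : Conf := fun k => w (k + j)

/-- The vertex on floor `n` that corresponds to the word of length `2 ^ n` which starts at the
origin. -/
def block : ∀ n, Conf → OP n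
  | 0, w => w 0
  | n + 1, w => (block n w, block n (shiftBy (2 ^ n : ℕ) w))

theorem letter_block (n : ℕ) (w : Conf) {i : ℕ} (hi : i < 2 ^ n) :
    OP.letter n (block n w) i = w i := by
  induction n generalizing w i with
  | zero =>
    obtain rfl : i = 0 := by simpa using hi
    rfl
  | succ n ih =>
    by_cases h : i < 2 ^ n
    · rw [OP.letter, if_pos h]
      exact ih w h
    · rw [OP.letter, if_neg h]
      refine (ih (shiftBy (2 ^ n : ℕ) w) (by rw [pow_succ] at hi; omega)).trans ?_
      rw [shiftBy, ← Nat.cast_add, Nat.sub_add_cancel (by omega)]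

/-- The path coded by `y`: its vertex on floor `n` is the word of length `2 ^ n` that occurs in the
first component around the origin, at the position given by the first `n` digits. -/
def decode (y : Conf × BSeq) : OPPath where
  vert n := block n (shiftBy (-(digitSum n y.2 : ℤ)) y.1)
  edge := y.2
  compat n := by
    have h : ∀ b, b = y.2 n → block n (shiftBy (-(digitSum n y.2 : ℤ)) y.1) =
        OP.child b (block (n + 1) (shiftBy (-(digitSum (n + 1) y.2 : ℤ)) y.1)) := fun b hb => by
      rw [digitSum_succ, ← hb]
      cases b
      · rw [Bool.toNat_false, zero_mul, add_zero]
        rfl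
      · rw [Bool.toNat_true, one_mul]
        refine congrArg (block n) (funext fun k => congrArg y.1 ?_)
        push_cast
        ring
    exact h _ rfl

/-! ### The orbit of a path under the adic transformation -/

theorem TailEqFrom.refl (n : ℕ) (x : OPPath) : TailEqFrom n x x := fun _ _ => ⟨rfl, rfl⟩

theorem TailEqFrom.trans {n : ℕ} {x y z : OPPath} (h : TailEqFrom n x y) (h' : TailEqFrom n y z) :
    TailEqFrom n x z := fun m hm =>
  ⟨(h m hm).1.trans (h' m hm).1, (h m hm).2.trans (h' m hm).2⟩

theorem TailEqFrom.symm {n : ℕ} {x y : OPPath} (h : TailEqFrom n x y) : TailEqFrom n y x :=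
  fun m hm => ⟨(h m hm).1.symm, (h m hm).2.symm⟩

theorem tailEqFrom_relabel (x : OPPath) (e : ℕ → Bool) (N : ℕ)
    (h : ∀ n, N ≤ n → e n = x.edge n) : TailEqFrom N x (x.relabel e N h) := fun m hm => by
  refine ⟨?_, (h m hm).symm⟩
  have : ∀ k, (OP.descend e)^[k] x.vert m = x.vert m := fun k => by
    induction k with
    | zero => rfl
    | succ k ih => rw [OP.descend_iterate_succ x e N h k m (by omega), ih]
  exact (this N).symm

theorem TailEqFrom.mono {n m : ℕ} (hnm : n ≤ m) {x y : OPPath} (h : TailEqFrom n x y) :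
    TailEqFrom m x y := fun k hk => h k (hnm.trans hk)

theorem exists_false_of_digitSum_lt {n : ℕ} {α : BSeq} (h : digitSum n α + 1 < 2 ^ n) :
    ∃ j < n, α j = false := by
  by_contra hcon
  have h1 : ∀ j < n, α j = true := fun j hj => by
    by_contra h2
    exact hcon ⟨j, hj, by simpa using h2⟩
  have h2 := digitSum_odometer n α
  rw [if_pos h1] at h2
  omega

theorem digitSum_odometer_of_lt {n : ℕ} {α : BSeq} (h : digitSum n α + 1 < 2 ^ n) :
    digitSum n (odometer α) = digitSum n α + 1 := by
  obtain ⟨j, hj, hf⟩ := exists_false_of_digitSum_lt h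
  rw [← digitSum_odometer, if_neg (fun h1 => by simp [h1 j hj] at hf), add_zero]

theorem digitSum_odometerInv_of_pos {n : ℕ} {α : BSeq} (h : 0 < digitSum n α) :
    digitSum n (odometerInv α) + 1 = digitSum n α := by
  have h1 := digitSum_odometer n (odometerInv α)
  have h2 := digitSum_lt n (odometerInv α)
  rw [odometer_odometerInv] at h1
  split_ifs at h1 <;> omega

theorem adic_spec {n : ℕ} {x : OPPath} (h : digitSum n x.edge + 1 < 2 ^ n) :
    TailEqFrom n x (adic x) ∧ digitSum n (adic x).edge = digitSum n x.edge + 1 := by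
  classical
  obtain ⟨j, hj, hf⟩ := exists_false_of_digitSum_lt h
  have hex : ∃ n, x.edge n = false := ⟨j, hf⟩
  rw [adic, dif_pos hex]
  have hle : Nat.find hex + 1 ≤ n := by
    have := Nat.find_min' hex hf
    omega
  exact ⟨(tailEqFrom_relabel x _ _ _).mono hle, digitSum_odometer_of_lt h⟩

theorem adicInv_spec {n : ℕ} {x : OPPath} (h : 0 < digitSum n x.edge) :
    TailEqFrom n x (adicInv x) ∧ digitSum n (adicInv x).edge + 1 = digitSum n x.edge := by
  classical
  obtain ⟨j, hj, hf⟩ : ∃ j < n, x.edge j = true := by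
    obtain ⟨j, hj, h0⟩ := Finset.exists_ne_zero_of_sum_ne_zero h.ne'
    refine ⟨j, Finset.mem_range.1 hj, ?_⟩
    by_contra h1
    simp [h1] at h0
  have hex : ∃ n, x.edge n = true := ⟨j, hf⟩
  rw [adicInv, dif_pos hex]
  have hle : Nat.find hex + 1 ≤ n := by
    have := Nat.find_min' hex hf
    omega
  exact ⟨(tailEqFrom_relabel x _ _ _).mono hle, digitSum_odometerInv_of_pos h⟩

/-- While the position stays inside the word on floor `n`, every carry stops below that floor, so
the adic map moves the position by 1 and leaves the tail alone. -/
theorem adicPow_spec {n : ℕ} {x : OPPath} {k : ℤ} (h0 : 0 ≤ digitSum n x.edge + k)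
    (h1 : digitSum n x.edge + k < (2 ^ n : ℕ)) :
    TailEqFrom n x (adicPow k x) ∧ (digitSum n (adicPow k x).edge : ℤ) = digitSum n x.edge + k := by
  have hpos : ∀ j : ℕ, digitSum n x.edge + j < 2 ^ n →
      TailEqFrom n x (adic^[j] x) ∧ digitSum n (adic^[j] x).edge = digitSum n x.edge + j := by
    intro j
    induction j with
    | zero => exact fun _ => ⟨TailEqFrom.refl n x, rfl⟩
    | succ j ih =>
      intro hj
      obtain ⟨h2, h3⟩ := ih (by omega)
      obtain ⟨h4, h5⟩ := adic_spec (n := n) (x := adic^[j] x) (by omega)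
      rw [Function.iterate_succ_apply']
      exact ⟨h2.trans h4, by omega⟩
  have hneg : ∀ j : ℕ, j ≤ digitSum n x.edge →
      TailEqFrom n x (adicInv^[j] x) ∧ digitSum n (adicInv^[j] x).edge + j = digitSum n x.edge := by
    intro j
    induction j with
    | zero => exact fun _ => ⟨TailEqFrom.refl n x, rfl⟩
    | succ j ih =>
      intro hj
      obtain ⟨h2, h3⟩ := ih (by omega)
      obtain ⟨h4, h5⟩ := adicInv_spec (n := n) (x := adicInv^[j] x) (by omega)
      rw [Function.iterate_succ_apply']
      exact ⟨h2.trans h4, by omega⟩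
  cases k with
  | ofNat j =>
    simp only [Int.ofNat_eq_natCast] at h0 h1
    obtain ⟨h2, h3⟩ := hpos j (by exact_mod_cast h1)
    exact ⟨h2, by simp only [adicPow, h3]; simp⟩
  | negSucc j =>
    rw [Int.negSucc_eq] at h0
    obtain ⟨h2, h3⟩ := hneg (j + 1) (by omega)
    exact ⟨h2, by simp only [adicPow, Int.negSucc_eq]; omega⟩

theorem coding_fst_apply {n : ℕ} {x : OPPath} {k : ℤ} (h0 : 0 ≤ digitSum n x.edge + k)
    (h1 : digitSum n x.edge + k < (2 ^ n : ℕ)) :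
    (coding x).1 k = OP.letter n (x.vert n) (digitSum n x.edge + k).toNat := by
  obtain ⟨h2, h3⟩ := adicPow_spec h0 h1
  change (adicPow k x).vert 0 = _
  rw [(adicPow k x).vert_zero n, ← (h2 n le_rfl).1, ← h3, Int.toNat_natCast]

/-- This needs no restriction on `x`: only coordinates inside the word on floor `n` are read, and
there the adic powers are defined. -/
theorem decode_coding (x : OPPath) : decode (coding x) = x := by
  refine OPPath.ext (funext fun n => OP.ext_letter fun i hi => ?_) rfl
  have hlt := digitSum_lt n x.edge
  refine (letter_block n _ hi).trans ?_
  change (coding x).1 (i + -(digitSum n x.edge : ℤ)) = _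
  rw [coding_fst_apply (n := n) (by omega) (by omega)]
  congr 1
  omega

/-- The sequences for which all powers of the odometer are reached within finitely many digits. -/
def goodSeq : Set BSeq :=
  {α | ∀ k : ℤ, ∃ n, 0 ≤ digitSum n α + k ∧ digitSum n α + k < (2 ^ n : ℕ)}

theorem digitSum_add_mono {n m : ℕ} (hnm : n ≤ m) {α : BSeq} {k : ℤ}
    (h : 0 ≤ digitSum n α + k ∧ digitSum n α + k < (2 ^ n : ℕ)) :
    0 ≤ digitSum m α + k ∧ digitSum m α + k < (2 ^ m : ℕ) := by
  induction m, hnm using Nat.le_induction with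
  | base => exact h
  | succ m _ ih =>
    rw [digitSum_succ, pow_succ]
    have : (0 : ℤ) < (2 ^ m : ℕ) := by positivity
    cases α m
    · simp only [Bool.toNat_false]; omega
    · simp only [Bool.toNat_true]; omega

theorem digitSum_add_digitSum {n m : ℕ} (hnm : n ≤ m) {α β : BSeq}
    (h : ∀ i, n ≤ i → α i = β i) : digitSum m α + digitSum n β = digitSum m β + digitSum n α := by
  induction m, hnm using Nat.le_induction with
  | base => exact add_comm _ _
  | succ m hm ih => rw [digitSum_succ, digitSum_succ, h m hm]; omega

theorem goodSeq_of_tail {n : ℕ} {α β : BSeq} (h : ∀ i, n ≤ i → α i = β i) (hα : α ∈ goodSeq) :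
    β ∈ goodSeq := fun k => by
  obtain ⟨m, hm⟩ := hα (digitSum n β - digitSum n α + k)
  have hm' := digitSum_add_mono (le_max_right n m) hm
  have := digitSum_add_digitSum (le_max_left n m) h
  exact ⟨max n m, by omega, by omega⟩

theorem coding_decode {y : Conf × BSeq} (hy : y.2 ∈ goodSeq) : coding (decode y) = y := by
  refine Prod.ext (funext fun k => ?_) rfl
  obtain ⟨n, h0, h1⟩ := hy k
  refine (coding_fst_apply (x := decode y) (n := n) h0 h1).trans ?_
  refine (letter_block n _ (i := (digitSum n y.2 + k).toNat) (by omega)).trans ?_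
  exact congrArg y.1 (by omega)

/-- The point on the orbit of `y` whose second coordinate begins with `n` zeros, the other digits
being the same as for `y`. -/
def basePoint (n : ℕ) (y : Conf × BSeq) : Conf × BSeq :=
  shiftOdometerEquiv.symm^[digitSum n y.2] y

theorem symm_iterate (j : ℕ) (y : Conf × BSeq) :
    shiftOdometerEquiv.symm^[j] y = (fun k => y.1 (k - j), odometerInv^[j] y.2) := by
  induction j with
  | zero => simp
  | succ j ih =>
    rw [Function.iterate_succ_apply', ih, Function.iterate_succ_apply']
    refine Prod.ext (funext fun k => ?_) rfl
    exact congrArg y.1 (by push_cast; ring)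

theorem iterate_symm_iterate (j : ℕ) (y : Conf × BSeq) :
    shiftOdometer^[j] (shiftOdometerEquiv.symm^[j] y) = y :=
  (Function.LeftInverse.iterate shiftOdometerEquiv.apply_symm_apply j) y

theorem digitClass_odometerInv_iterate (n k : ℕ) (α : BSeq) :
    digitClass n (odometerInv^[k] α) = digitClass n α - k := by
  induction k with
  | zero => simp
  | succ k ih => rw [Function.iterate_succ_apply', digitClass_odometerInv, ih]; push_cast; ring

/-- Moving back to the left end of the word on floor `n` removes all dependence on the first `n`
edges. Hence base points encode the tail. -/
theorem basePoint_coding_eq {n : ℕ} {x y : OPPath} (h : TailEqFrom n x y)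
    (hx : x.edge ∈ goodSeq) : basePoint n (coding x) = basePoint n (coding y) := by
  have hd : ∀ m, n ≤ m → digitSum m x.edge + digitSum n y.edge =
      digitSum m y.edge + digitSum n x.edge := fun m hm =>
    digitSum_add_digitSum hm fun i hi => (h i hi).2
  rw [basePoint, basePoint, symm_iterate, symm_iterate]
  refine Prod.ext (funext fun k => ?_) (ext_digitClass fun m => ?_)
  · change (coding x).1 (k - digitSum n x.edge) = (coding y).1 (k - digitSum n y.edge)
    obtain ⟨m, hm⟩ := hx (k - digitSum n x.edge)
    obtain ⟨h0, h1⟩ := digitSum_add_mono (le_max_right n m) hm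
    have h2 := hd _ (le_max_left n m)
    rw [coding_fst_apply (n := max n m) h0 h1, coding_fst_apply (n := max n m) (by omega)
      (by omega), (h _ (le_max_left n m)).1]
    congr 1
    omega
  · change digitClass m (odometerInv^[digitSum n x.edge] x.edge) =
      digitClass m (odometerInv^[digitSum n y.edge] y.edge)
    rw [digitClass_odometerInv_iterate, digitClass_odometerInv_iterate]
    rcases le_total n m with hm | hm
    · have := congrArg (Nat.cast : ℕ → ZMod (2 ^ m)) (hd m hm)
      push_cast at this
      rw [digitClass, digitClass]
      linear_combination this
    · have h1 : ∀ α : BSeq, digitClass m α - (digitSum n α : ZMod (2 ^ m)) = 0 := fun α => by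
        rw [digitClass, ← digitSum_mod hm α, ZMod.natCast_mod, sub_self]
      exact (h1 x.edge).trans (h1 y.edge).symm

theorem tailEqFrom_decode {n : ℕ} {y : Conf × BSeq} (h : digitSum n y.2 + 1 < 2 ^ n) :
    TailEqFrom n (decode y) (decode (shiftOdometer y)) := fun m hm => by
  have h1 := digitSum_add_mono hm (α := y.2) (k := 1) ⟨by omega, by exact_mod_cast h⟩
  have h2 : digitSum m (odometer y.2) = digitSum m y.2 + 1 :=
    digitSum_odometer_of_lt (by exact_mod_cast h1.2)
  constructor
  · change block m _ = block m (shiftBy (-(digitSum m (odometer y.2) : ℤ)) (shift y.1))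
    rw [h2]
    exact congrArg (block m) (funext fun k => congrArg y.1 (by push_cast; ring))
  · obtain ⟨j, hj, hf⟩ := exists_false_of_digitSum_lt h
    exact (odometer_tail y.2 j hf m (by omega)).symm

/-! ### Measurability of the coding -/

instance (n : ℕ) : Countable (OP n) := by
  induction n with
  | zero => exact inferInstanceAs (Countable Bool)
  | succ n ih => exact inferInstanceAs (Countable (OP n × OP n))

theorem measurable_shiftBy (j : ℤ) : Measurable (shiftBy j) :=
  measurable_pi_lambda _ fun _ => measurable_pi_apply _

theorem measurable_block (n : ℕ) : Measurable (block n) := by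
  induction n with
  | zero =>
    refine measurable_to_countable' fun v => ?_
    exact (measurable_pi_apply (0 : ℤ)) (measurableSet_singleton (α := Bool) v)
  | succ n ih =>
    refine measurable_to_countable' fun v => ?_
    have : block (n + 1) ⁻¹' {v} = block n ⁻¹' {OP.child false v} ∩
        (fun w => block n (shiftBy (2 ^ n : ℕ) w)) ⁻¹' {OP.child true v} := by
      ext w
      exact Prod.ext_iff (α := OP n) (β := OP n)
    rw [this]
    exact (ih trivial).inter ((ih.comp (measurable_shiftBy _)) trivial)

theorem measurable_decode : Measurable decode := by
  refine measurable_comap_iff.2 ((measurable_pi_lambda _ fun n => ?_).prodMk measurable_snd)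
  have h : Measurable fun p : Conf × ℕ => block n (shiftBy (-(p.2 : ℤ)) p.1) :=
    measurable_from_prod_countable_left fun d => (measurable_block n).comp
      (measurable_shiftBy (-(d : ℤ)))
  exact h.comp (measurable_fst.prodMk ((measurable_digitSum n).comp measurable_snd))

theorem measurable_edge : Measurable OPPath.edge :=
  measurable_snd.comp (comap_measurable fun x : OPPath => (x.vert, x.edge))

theorem measurable_vert (n : ℕ) : Measurable fun x : OPPath => x.vert n :=
  (measurable_pi_apply n).comp
    (measurable_fst.comp (comap_measurable fun x : OPPath => (x.vert, x.edge)))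

theorem measurableSet_goodSeq : MeasurableSet goodSeq := by
  simp only [goodSeq, ofPred_forall, ofPred_exists]
  exact MeasurableSet.iInter fun k => MeasurableSet.iUnion fun n =>
    (measurable_digitSum n) (MeasurableSet.of_discrete
      (s := {d : ℕ | 0 ≤ (d : ℤ) + k ∧ (d : ℤ) + k < (2 ^ n : ℕ)}))

/-- At level `n` the forbidden residues have total measure at most K·2^(-n), which tends to 0. -/
theorem ae_notMem_labels (K : ℕ) (s : ∀ n, ℕ → ZMod (2 ^ n)) :
    ∀ᵐ α ∂lebesgue, ∃ n, ∀ i < K, digitClass n α ≠ s n i := by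
  rw [ae_iff]
  refine le_antisymm (le_of_forall_pos_le_add fun ε hε => ?_) zero_le
  rw [zero_add]
  have hb : ∀ n, lebesgue {α | ¬∃ n, ∀ i < K, digitClass n α ≠ s n i} ≤
      K * ((2 : ENNReal)⁻¹) ^ n := fun n => by
    calc _ ≤ lebesgue (⋃ i ∈ Finset.range K, digitClass n ⁻¹' {s n i}) := by
          refine measure_mono fun α hα => ?_
          simp only [mem_ofPred_eq, not_exists, not_forall, not_not] at hα
          obtain ⟨i, hi, h⟩ := hα n
          exact mem_iUnion₂.2 ⟨i, Finset.mem_range.2 hi, h⟩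
      _ ≤ ∑ i ∈ Finset.range K, lebesgue (digitClass n ⁻¹' {s n i}) :=
          measure_biUnion_finset_le _ _
      _ = K * ((2 : ENNReal)⁻¹) ^ n := by
          simp [lebesgue_fiber, ENNReal.inv_pow]
  have ht : Filter.Tendsto (fun n => (K : ENNReal) * ((2 : ENNReal)⁻¹) ^ n) Filter.atTop
      (nhds (K * 0)) :=
    ENNReal.Tendsto.const_mul (ENNReal.tendsto_pow_atTop_nhds_zero_of_lt_one (by simp))
      (Or.inr (ENNReal.natCast_ne_top K))
  rw [mul_zero] at ht
  exact (ge_of_tendsto' ht hb).trans zero_le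

/-- A shift by `k` fails at level `n` only if the position is among the |k| first or last ones of
the word. -/
theorem ae_goodSeq : ∀ᵐ α ∂lebesgue, α ∈ goodSeq := by
  refine ae_all_iff.2 fun k => ?_
  filter_upwards [ae_notMem_labels k.natAbs fun n i => (i : ZMod (2 ^ n)),
    ae_notMem_labels k.natAbs fun n i => -1 - (i : ZMod (2 ^ n))] with α h1 h2
  rcases le_total 0 k with hk | hk
  · obtain ⟨n, hn⟩ := h2
    have hlt := digitSum_lt n α
    refine ⟨n, by omega, ?_⟩
    by_contra hcon
    refine hn (2 ^ n - 1 - digitSum n α) (by omega) ?_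
    rw [Nat.sub_sub, Nat.cast_sub (by omega), ZMod.natCast_self, digitClass]
    push_cast; ring
  · obtain ⟨n, hn⟩ := h1
    have hlt := digitSum_lt n α
    refine ⟨n, ?_, by omega⟩
    by_contra hcon
    exact hn (digitSum n α) (by omega) rfl

/-- A measurable version of the coding. -/
noncomputable def codingAux (x : OPPath) : Conf × BSeq := by
  classical exact
  (fun k => decide (∃ n i, digitSum n x.edge = i ∧ 0 ≤ (i : ℤ) + k ∧ (i : ℤ) + k < (2 ^ n : ℕ) ∧
    OP.letter n (x.vert n) (i + k).toNat = true), x.edge)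

theorem measurable_codingAux : Measurable codingAux := by
  refine (measurable_pi_lambda _ fun k => measurable_to_bool ?_).prodMk measurable_edge
  have : (fun x => (codingAux x).1 k) ⁻¹' {true} = ⋃ n, ⋃ i : ℕ,
      {x : OPPath | digitSum n x.edge = i ∧ 0 ≤ (i : ℤ) + k ∧ (i : ℤ) + k < (2 ^ n : ℕ) ∧
        OP.letter n (x.vert n) (i + k).toNat = true} := by
    ext x
    simp [codingAux]
  refine this ▸ MeasurableSet.iUnion fun n => MeasurableSet.iUnion fun i => ?_
  refine MeasurableSet.inter
    (((measurable_digitSum n).comp measurable_edge) (measurableSet_singleton i)) ?_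
  refine MeasurableSet.inter (MeasurableSet.const _) (MeasurableSet.inter (MeasurableSet.const _) ?_)
  have ht : MeasurableSet {v : OP n | OP.letter n v (i + k).toNat = true} := trivial
  exact measurable_vert n ht

/-- Every floor whose word reaches coordinate `k` gives the same letter, and for good sequences such
a floor exists. This gives almost everywhere measurability of `coding` without that of the adic map.
-/
theorem codingAux_eq {x : OPPath} (hx : x.edge ∈ goodSeq) : codingAux x = coding x := by
  refine Prod.ext (funext fun k => ?_) rfl
  rw [Bool.eq_iff_iff]
  simp only [codingAux, decide_eq_true_eq]
  constructor
  · rintro ⟨n, i, rfl, h0, h1, h⟩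
    rw [coding_fst_apply h0 h1, h]
  · intro h
    obtain ⟨n, h0, h1⟩ := hx k
    exact ⟨n, _, rfl, h0, h1, by rwa [← coding_fst_apply h0 h1]⟩

/-! ### Central measures on paths and invariant measures -/

section Central

variable {μ : Measure OPPath} {ν : Measure (Conf × BSeq)}

theorem ae_goodSeq_edge (h : μ.map OPPath.edge = lebesgue) : ∀ᵐ x ∂μ, x.edge ∈ goodSeq :=
  ae_of_ae_map measurable_edge.aemeasurable (h ▸ ae_goodSeq)

theorem codingAux_ae_eq (h : μ.map OPPath.edge = lebesgue) : codingAux =ᵐ[μ] coding :=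
  (ae_goodSeq_edge h).mono fun _ => codingAux_eq

theorem aemeasurable_coding (h : μ.map OPPath.edge = lebesgue) : AEMeasurable coding μ :=
  ⟨codingAux, measurable_codingAux, (codingAux_ae_eq h).symm⟩

theorem edge_eq_iff {n : ℕ} {α β : BSeq} :
    (∀ i : Fin n, α i = β i) ↔ digitClass n α = digitClass n β := by
  refine ⟨fun h => ?_, fun h i => apply_eq_of_digitClass_eq h i.2⟩
  rw [digitClass, digitClass, digitSum_congr fun i hi => h ⟨i, hi⟩]

theorem exists_extend {n : ℕ} (a : Fin n → Bool) : ∃ α : BSeq, ∀ i : Fin n, α i = a i :=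
  ⟨fun i => if h : i < n then a ⟨i, h⟩ else false, fun i => by simp⟩

/-- In a central measure, events that depend on the tail are independent of the residue. -/
theorem IsCentral.measure_inter_eq (h : IsCentral μ) {n : ℕ} {B : Set OPPath} (hB : MeasurableSet B)
    (hB' : ∀ x y, TailEqFrom n x y → (x ∈ B ↔ y ∈ B)) (r s : ZMod (2 ^ n)) :
    μ (B ∩ {x | digitClass n x.edge = r}) = μ (B ∩ {x | digitClass n x.edge = s}) := by
  obtain ⟨α, rfl⟩ := exists_digitClass_eq n r
  obtain ⟨β, rfl⟩ := exists_digitClass_eq n s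
  have := h.2 n (fun i => α i) (fun i => β i) B hB hB'
  simpa only [edge_eq_iff] using this

theorem IsCentral.map_edge (h : IsCentral μ) : μ.map OPPath.edge = lebesgue := by
  have := h.1
  have := Measure.isProbabilityMeasure_map (μ := μ) measurable_edge.aemeasurable
  refine measure_ext_digitClass 0 fun n _ r => ?_
  rw [lebesgue_fiber, Measure.map_apply measurable_edge
    (measurable_digitClass n (measurableSet_singleton r)), ← preimage_comp]
  refine CyclicFactor.measure_fiber_of_forall_eq ((measurable_digitClass n).comp measurable_edge)
    (fun s => ?_) r
  simpa using! h.measure_inter_eq MeasurableSet.univ (fun _ _ _ => Iff.rfl) s 0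

theorem measurable_basePoint (n : ℕ) : Measurable (basePoint n) := by
  have h : Measurable fun p : (Conf × BSeq) × ℕ => shiftOdometerEquiv.symm^[p.2] p.1 :=
    measurable_from_prod_countable_left fun d => shiftOdometerEquiv.symm.measurable.iterate d
  exact h.comp (measurable_id.prodMk ((measurable_digitSum n).comp measurable_snd))

/-- Events that depend on the base point only, pulled back to the space of paths. -/
theorem tail_invariant_of_basePoint {n : ℕ} {F : Set (Conf × BSeq)} {x y : OPPath}
    (h : TailEqFrom n x y) :
    (x.edge ∈ goodSeq ∧ basePoint n (codingAux x) ∈ F) ↔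
      (y.edge ∈ goodSeq ∧ basePoint n (codingAux y) ∈ F) := by
  have key : ∀ {x y : OPPath}, TailEqFrom n x y →
      (x.edge ∈ goodSeq ∧ basePoint n (codingAux x) ∈ F) →
      (y.edge ∈ goodSeq ∧ basePoint n (codingAux y) ∈ F) := fun {x y} h hx => by
    have hy := goodSeq_of_tail (fun i hi => (h i hi).2) hx.1
    refine ⟨hy, ?_⟩
    rw [codingAux_eq hy, ← basePoint_coding_eq h hx.1, ← codingAux_eq hx.1]
    exact hx.2
  exact ⟨key h, key h.symm⟩

/-- Both events say that the base point moved j + 1 steps lies in `F`. This depends on the tail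
only, so centrality allows the residue j to be exchanged for j + 1. -/
theorem IsCentral.measure_preimage_residue (h : IsCentral μ) {n j : ℕ} (hj : j + 1 < 2 ^ n)
    {F : Set (Conf × BSeq)} (hF : MeasurableSet F) :
    μ.map coding (shiftOdometer ⁻¹' F ∩ residue n ⁻¹' {(j : ZMod (2 ^ n))}) =
      μ.map coding (F ∩ residue n ⁻¹' {((j + 1 : ℕ) : ZMod (2 ^ n))}) := by
  have hgood := ae_goodSeq_edge h.map_edge
  rw [← Measure.map_congr (codingAux_ae_eq h.map_edge),
    Measure.map_apply measurable_codingAux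
      ((measurable_shiftOdometer hF).inter (measurableSet_residue n _)),
    Measure.map_apply measurable_codingAux (hF.inter (measurableSet_residue n _))]
  let F' : Set (Conf × BSeq) := shiftOdometer^[j + 1] ⁻¹' F
  let B : Set OPPath := {x | x.edge ∈ goodSeq ∧ basePoint n (codingAux x) ∈ F'}
  have hB : MeasurableSet B := (measurable_edge measurableSet_goodSeq).inter
    (((measurable_basePoint n).comp measurable_codingAux)
      ((measurable_shiftOdometer.iterate (j + 1)) hF))
  have hval : ∀ {i : ℕ}, i < 2 ^ n → ∀ {x : OPPath}, digitClass n x.edge = (i : ZMod (2 ^ n)) →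
      digitSum n x.edge = i := fun hi x hx => by
    rw [← digitClass_val, hx, ZMod.val_cast_of_lt hi]
  have hbase : ∀ {i : ℕ}, i < 2 ^ n → ∀ {x : OPPath}, digitClass n x.edge = (i : ZMod (2 ^ n)) →
      shiftOdometer^[i] (basePoint n (codingAux x)) = codingAux x := fun {i} hi x hx => by
    have h1 : digitSum n (codingAux x).2 = i := hval hi hx
    rw [basePoint, h1, iterate_symm_iterate]
  have h1 := h.measure_inter_eq hB (fun x y => tail_invariant_of_basePoint) (j : ZMod (2 ^ n))
    ((j + 1 : ℕ) : ZMod (2 ^ n))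
  refine (measure_congr ?_).trans (h1.trans (measure_congr ?_))
  · filter_upwards [hgood] with x hx
    refine propext (and_congr_left fun hr => ?_)
    have := hbase (by omega) hr
    simp only [B, F', mem_ofPred_eq, mem_preimage, hx, true_and, Function.iterate_succ_apply', this]
  · filter_upwards [hgood] with x hx
    refine propext (and_congr_left fun hr => ?_)
    have := hbase hj hr
    simp only [B, F', mem_ofPred_eq, mem_preimage, hx, true_and, this]

/-- Invariance holds on all residues but the last one, of mass 2^(-n). In the limit the image
measure is bounded by the original one, and two comparable probability measures are equal. -/
theorem IsCentral.map_coding_mem (h : IsCentral μ) : μ.map coding ∈ prodInv := by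
  have := h.1
  have hc := aemeasurable_coding h.map_edge
  have := Measure.isProbabilityMeasure_map hc
  refine ⟨⟨measurable_shiftOdometer, ?_⟩, this⟩
  have hp := Measure.isProbabilityMeasure_map (μ := μ.map coding)
    measurable_shiftOdometer.aemeasurable
  have hsnd : ∀ n r, μ.map coding (residue n ⁻¹' {r}) = ((2 ^ n : ℕ) : ENNReal)⁻¹ := fun n r => by
    rw [Measure.map_apply_of_aemeasurable hc (measurableSet_residue n r), ← lebesgue_fiber n r,
      ← h.map_edge, Measure.map_apply measurable_edge
        (measurable_digitClass n (measurableSet_singleton r))]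
    rfl
  have hsum : ∀ (n : ℕ) {G : Set (Conf × BSeq)}, MeasurableSet G →
      μ.map coding G = ∑ r, μ.map coding (G ∩ residue n ⁻¹' {r}) := fun n G hG => by
    have := sum_measure_preimage_singleton (μ := (μ.map coding).restrict G) (f := residue n)
      Finset.univ fun r _ => measurableSet_residue n r
    rw [Finset.coe_univ, preimage_univ, Measure.restrict_apply_univ] at this
    rw [← this]
    refine Finset.sum_congr rfl fun r _ => ?_
    rw [Measure.restrict_apply (measurableSet_residue n r), inter_comm]
  have hle : (μ.map coding).map shiftOdometer ≤ μ.map coding := by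
    refine Measure.le_iff.2 fun F hF => ?_
    rw [Measure.map_apply measurable_shiftOdometer hF]
    have hb : ∀ n, μ.map coding (shiftOdometer ⁻¹' F) ≤
        μ.map coding F + ((2 : ENNReal)⁻¹) ^ n := fun n => by
      have hterm : ∀ r, μ.map coding (shiftOdometer ⁻¹' F ∩ residue n ⁻¹' {r}) ≤
          μ.map coding (F ∩ residue n ⁻¹' {r + 1}) +
            if r = -1 then ((2 : ENNReal)⁻¹) ^ n else 0 := fun r => by
        split_ifs with hr
        · refine (measure_mono inter_subset_right).trans (le_add_left ?_)
          rw [hsnd, ← ENNReal.inv_pow]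
          push_cast
          rfl
        · have hj : r.val + 1 < 2 ^ n := by
            have h1 := CyclicFactor.val_sub_one (r + 1)
            rw [add_sub_cancel_right, if_neg fun h0 => hr (eq_neg_of_add_eq_zero_left h0)] at h1
            rw [h1]
            exact ZMod.val_lt _
          have h2 := h.measure_preimage_residue hj hF
          rw [Nat.cast_succ, ZMod.natCast_zmod_val] at h2
          rw [h2, add_zero]
      rw [hsum n (measurable_shiftOdometer hF), hsum n hF,
        ← Equiv.sum_comp (Equiv.addRight (1 : ZMod (2 ^ n)))
          (fun r => μ.map coding (F ∩ residue n ⁻¹' {r}))]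
      refine (Finset.sum_le_sum fun r _ => hterm r).trans ?_
      rw [Finset.sum_add_distrib, Finset.sum_ite_eq' Finset.univ, if_pos (Finset.mem_univ _)]
      rfl
    have ht : Filter.Tendsto (fun n => μ.map coding F + ((2 : ENNReal)⁻¹) ^ n) Filter.atTop
        (nhds (μ.map coding F + 0)) :=
      tendsto_const_nhds.add (ENNReal.tendsto_pow_atTop_nhds_zero_of_lt_one (by simp))
    rw [add_zero] at ht
    exact ge_of_tendsto' ht hb
  exact Measure.eq_of_le_of_isProbabilityMeasure hle

theorem map_decode_map_coding (h : μ.map OPPath.edge = lebesgue) :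
    (μ.map coding).map decode = μ := by
  rw [AEMeasurable.map_map_of_aemeasurable measurable_decode.aemeasurable (aemeasurable_coding h)]
  have : decode ∘ coding = id := funext decode_coding
  rw [this, Measure.map_id]

theorem map_edge_map_decode (hν : ν ∈ prodInv) : (ν.map decode).map OPPath.edge = lebesgue := by
  have := hν.2
  rw [Measure.map_map measurable_edge measurable_decode]
  exact (measurePreserving_of_odometer hν.1 measurable_snd
    (Filter.Eventually.of_forall fun _ => rfl)).map_eq

theorem ae_goodSeq_snd (hν : ν ∈ prodInv) : ∀ᵐ y ∂ν, y.2 ∈ goodSeq :=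
  have h := ae_goodSeq_edge (map_edge_map_decode hν)
  ae_of_ae_map measurable_decode.aemeasurable h

theorem map_coding_map_decode (hν : ν ∈ prodInv) : (ν.map decode).map coding = ν := by
  rw [AEMeasurable.map_map_of_aemeasurable (aemeasurable_coding (map_edge_map_decode hν))
    measurable_decode.aemeasurable]
  conv_rhs => rw [← Measure.map_id (μ := ν)]
  refine Measure.map_congr ?_
  filter_upwards [ae_goodSeq_snd hν] with y hy
  exact coding_decode hy

/-- One step of 𝕊 × 𝕆 from residue j to j + 1 < 2^n does not change the tail of the decoded path, so
invariance makes all residues equiprobable on a tail event. -/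
theorem isCentral_map_decode (hν : ν ∈ prodInv) : IsCentral (ν.map decode) := by
  have := hν.2
  refine ⟨Measure.isProbabilityMeasure_map measurable_decode.aemeasurable, ?_⟩
  intro n a b B hB hBt
  obtain ⟨α, hα⟩ := exists_extend a
  obtain ⟨β, hβ⟩ := exists_extend b
  have hset : ∀ γ : BSeq, MeasurableSet {x : OPPath | digitClass n x.edge = digitClass n γ} :=
    fun γ => ((measurable_digitClass n).comp measurable_edge) (measurableSet_singleton _)
  simp only [← hα, ← hβ, edge_eq_iff]
  rw [Measure.map_apply measurable_decode (hB.inter (hset α)),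
    Measure.map_apply measurable_decode (hB.inter (hset β))]
  have key : ∀ j : ℕ, j < 2 ^ n → ν (decode ⁻¹' B ∩ residue n ⁻¹' {(j : ZMod (2 ^ n))}) =
      ν (decode ⁻¹' B ∩ residue n ⁻¹' {0}) := fun j => by
    induction j with
    | zero => simp
    | succ j ih =>
      intro hj
      rw [← ih (by omega), ← hν.1.measure_preimage
        ((measurable_decode hB).inter (measurableSet_residue n _)).nullMeasurableSet]
      congr 1
      ext y
      have hr : residue n (shiftOdometer y) = ((j + 1 : ℕ) : ZMod (2 ^ n)) ↔
          residue n y = (j : ZMod (2 ^ n)) := by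
        rw [residue_shiftOdometer, Nat.cast_succ, add_left_inj]
      simp only [mem_preimage, mem_inter_iff, mem_singleton_iff, hr]
      refine and_congr_left fun hy => (hBt _ _ (tailEqFrom_decode ?_)).symm
      rw [← digitClass_val, show digitClass n y.2 = _ from hy, ZMod.val_cast_of_lt (by omega)]
      exact hj
  have key' : ∀ γ : BSeq, ν (decode ⁻¹' (B ∩ {x | digitClass n x.edge = digitClass n γ})) =
      ν (decode ⁻¹' B ∩ residue n ⁻¹' {0}) := fun γ => by
    rw [← key _ (digitSum_lt n γ)]
    rfl
  rw [key', key']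

theorem map_decode_mem_centralErg (hν : ν ∈ prodErg) : ν.map decode ∈ centralErg := by
  have hi := prodErg_subset_prodInv hν
  have := hν.2
  refine ⟨isCentral_map_decode hi, fun B hB hBt => ?_⟩
  rw [Measure.map_apply measurable_decode hB]
  have hm := measurable_decode hB
  have hinv : shiftOdometer ⁻¹' (decode ⁻¹' B) =ᵐ[ν] decode ⁻¹' B := by
    filter_upwards [ae_goodSeq_snd hi] with y hy
    obtain ⟨n, -, h1⟩ := hy 1
    exact propext (hBt _ _ ⟨n, tailEqFrom_decode (by exact_mod_cast h1)⟩).symm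
  rcases hν.1.quasiErgodic.ae_mem_or_ae_notMem₀ hm.nullMeasurableSet hinv with h | h
  · exact Or.inr ((prob_compl_eq_zero_iff hm).1 h)
  · exact Or.inl (measure_eq_zero_iff_ae_notMem.2 h)

theorem map_coding_mem_prodErg (hμ : μ ∈ centralErg) : μ.map coding ∈ prodErg := by
  obtain ⟨hc, herg⟩ := hμ
  have hi := hc.map_coding_mem
  have := hc.1
  refine ⟨⟨hi.1, ⟨fun E hE hEi => ?_⟩⟩, hi.2⟩
  rw [Filter.eventuallyConst_set, ← Measure.map_congr (codingAux_ae_eq hc.map_edge),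
    ae_map_iff (p := fun y => y ∈ E) measurable_codingAux.aemeasurable hE,
    ae_map_iff (p := fun y => y ∉ E) measurable_codingAux.aemeasurable hE.compl]
  -- A base point lies on the orbit of `y`, so an invariant set cannot distinguish them; its
  -- pullback to paths is therefore invariant under the tail equivalence.
  have hE' : ∀ n y, basePoint n y ∈ E ↔ y ∈ E := fun n y => by
    have h1 : ∀ j : ℕ, ∀ z, shiftOdometer^[j] z ∈ E ↔ z ∈ E := fun j z => by
      rw [← mem_preimage, Function.IsFixedPt.preimage_iterate hEi j]
    rw [← h1 (digitSum n y.2), basePoint, iterate_symm_iterate]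
  let B : Set OPPath := {x | x.edge ∈ goodSeq ∧ codingAux x ∈ E}
  have hB : MeasurableSet B :=
    (measurable_edge measurableSet_goodSeq).inter (measurable_codingAux hE)
  have hgood := ae_goodSeq_edge hc.map_edge
  have hBt : ∀ x y, (∃ n, TailEqFrom n x y) → (x ∈ B ↔ y ∈ B) := by
    rintro x y ⟨n, h⟩
    have := tail_invariant_of_basePoint (F := E) h
    rwa [hE', hE'] at this
  rcases herg B hB hBt with h | h
  · right
    filter_upwards [hgood, measure_eq_zero_iff_ae_notMem.1 h] with x hx hxB hxE
    exact hxB ⟨hx, hxE⟩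
  · left
    have h2 : ∀ᵐ x ∂μ, x ∈ B := (prob_compl_eq_zero_iff hB).2 h
    exact h2.mono fun x hx => hx.2

theorem bijOn_map_coding :
    BijOn (fun μ : Measure OPPath => μ.map coding) centralErg prodErg := by
  refine ⟨fun μ => map_coding_mem_prodErg, fun μ hμ μ' hμ' h => ?_, fun ν hν => ?_⟩
  · have := congrArg (fun ν => ν.map decode) h
    simpa only [map_decode_map_coding hμ.1.map_edge, map_decode_map_coding hμ'.1.map_edge] using this
  · exact ⟨_, map_decode_mem_centralErg hν, map_coding_map_decode (prodErg_subset_prodInv hν)⟩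

end Central

theorem theorem4 :
    -- the ergodic central measures on the path space are the ergodic measures in `𝕄`
    BijOn (fun μ : Measure OPPath => μ.map coding) centralErg prodErg ∧
    -- the ergodic measures in `𝕄` are divided into two disjoint classes
    prodErg =
      (⋃ k : ℕ, D k '' (shiftInv k ∩ extremePoints ENNReal (shiftInv (k + 1)))) ∪
      {ν | ∃ η ∈ shiftErg, HasOdometerFactor η ∧
        ∃ f, IsEigenSystem η f ∧ ∃ α, IsNuAlpha η f α ν} ∧
    Disjoint
      (⋃ k : ℕ, D k '' (shiftInv k ∩ extremePoints ENNReal (shiftInv (k + 1))))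
      {ν | ∃ η ∈ shiftErg, HasOdometerFactor η ∧
        ∃ f, IsEigenSystem η f ∧ ∃ α, IsNuAlpha η f α ν} ∧
    -- 1) the measures of periodic type
    (∀ k : ℕ,
      (∀ η ∈ shiftInv k, D k η ∈ prodErg ↔ η ∈ extremePoints ENNReal (shiftInv (k + 1))) ∧
      {ν | ν ∈ prodErg ∧ IsPeriodicType k ν} =
        D k '' {η | η ∈ shiftInv k ∩ extremePoints ENNReal (shiftInv (k + 1)) ∧
          ∀ j < k, η ∉ shiftInv j} ∧
      proj '' {ν | ν ∈ prodErg ∧ IsPeriodicType k ν} =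
        {η | η ∈ shiftErg ∧ HasRotationFactor η k ∧ ¬ HasRotationFactor η (k + 1)}) ∧
    -- 2) the aperiodic measures
    {ν | ν ∈ prodErg ∧ IsAperiodic ν} =
      {ν | ∃ η ∈ shiftErg, HasOdometerFactor η ∧
        ∃ f, IsEigenSystem η f ∧ ∃ α, IsNuAlpha η f α ν} ∧
    (∀ η ∈ shiftErg, HasOdometerFactor η →
      (∃ f, IsEigenSystem η f) ∧
      ∀ f, IsEigenSystem η f →
        (∀ α, ∃! ν, IsNuAlpha η f α ν) ∧
        {ν | ν ∈ prodErg ∧ IsAperiodic ν ∧ proj ν = η} = {ν | ∃ α, IsNuAlpha η f α ν}) := by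
  have hper : ∀ k : ℕ, D k '' (shiftInv k ∩ extremePoints ENNReal (shiftInv (k + 1))) ⊆
      {ν | ν ∈ prodErg ∧ ∃ k, IsPeriodicType k ν} := by
    rintro k ν ⟨η, ⟨hη, he⟩, rfl⟩
    exact ⟨(D_mem_prodErg_iff hη).2 he, exists_isPeriodicType_iff.2 ⟨k, η, hη, rfl⟩⟩
  refine ⟨bijOn_map_coding, ?_, ?_, fun k => ⟨fun η hη => D_mem_prodErg_iff hη,
    ergodic_periodicType_eq k, proj_ergodic_periodicType_eq k⟩, ergodic_aperiodic_eq,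
    fun η hη ho => ⟨exists_eigenSystem ho, fun f hf =>
      ⟨existsUnique_isNuAlpha hη hf, ergodic_aperiodic_proj_eq hη hf⟩⟩⟩
  · rw [← ergodic_aperiodic_eq]
    ext ν
    constructor
    · intro h
      by_cases hp : ∃ k, IsPeriodicType k ν
      · obtain ⟨k, hk⟩ := hp
        have : ν ∈ {ν | ν ∈ prodErg ∧ IsPeriodicType k ν} := ⟨h, hk⟩
        rw [ergodic_periodicType_eq] at this
        obtain ⟨η, hη, rfl⟩ := this
        exact Or.inl (mem_iUnion.2 ⟨k, η, hη.1, rfl⟩)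
      · exact Or.inr ⟨h, prodErg_subset_prodInv h, hp⟩
    · rintro (h | h)
      · obtain ⟨k, hk⟩ := mem_iUnion.1 h
        exact (hper k hk).1
      · exact h.1
  · rw [← ergodic_aperiodic_eq, disjoint_left]
    intro ν h h'
    obtain ⟨k, hk⟩ := mem_iUnion.1 h
    exact h'.2.2 (hper k hk).2
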